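/- Let $m,n\ge 1$ and $p,q\ge 0$ be integers, let $A\in\mathbb C^{p\times m}$, $B\in\mathbb C^{n\times q}$, $C\in\mathbb C^{p\times n}$, $D\in\mathbb C^{m\times q}$, let $\star$ be either the transpose $\top$ or the conjugate transpose $*$, and consider the matrix pencil of size $(p+q)\times(m+n)$ $$\mathcal Q(\lambda)=\begin{bmatrix}\lambda D^\star & B^\star\\ A & \lambda C\end{bmatrix}.$$ Terminology. A pencil $\mathcal P(\lambda)=\lambda M+N$ is regular if it is square and $\det\mathcal P(\lambda)$ is not identically zero. The spectrum $\Lambda(\mathcal P)\subseteq\mathbb C\cup\{\infty\}$ of a regular pencil consists of the roots of $\det\mathcal P(\lambda)$, together with $\infty$ if the degree of $\det\mathcal P(\lambda)$ is less than the size of $\mathcal P$. For $\mu\in\mathbb C$, $m_\mu(\mathcal P)$ is the multiplicity of $\mu$ as a root of $\det\mathcal P(\lambda)$ ($0$ if $\mu$ is not a root), and $m_\infty(\mathcal P)$ is the multiplicity of $0$ as a root of $\det(\lambda N+M)$. A set $\mathcal S\subseteq\mathbb C\cup\{\infty\}$ is reciprocal free if $\lambda\ne\mu^{-1}$ for all $\lambda,\mu\in\mathcal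 S$, and $*$-reciprocal free if $\lambda\neq(\overline\mu)^{-1}$ for all $\lambda,\mu\in\mathcal S$ (the case $\lambda=\mu$ included), where $0^{-1}=\infty$, $\infty^{-1}=0$ and $\overline\infty=\infty$. A set $\mathcal S\subseteq\Lambda(\mathcal Q)$ is called admissible here if - for $\star=\top$: $\mathcal S\setminus\{1,-1\}$ is reciprocal free and $m_1(\mathcal Q)=m_{-1}(\mathcal Q)\le 1$; - for $\star=*$: $\mathcal S$ is $*$-reciprocal free. Let $\widehat\Lambda(\mathcal Q)$ be $\Lambda(\mathcal Q)$ if $m_\infty(\mathcal Q)>|m-n|$ and $\Lambda(\mathcal Q)\setminus\{\infty\}$ otherwise; let $\widetilde\Lambda(\mathcal Q)$ be $\Lambda(\mathcal Q)$ if $m_0(\mathcal Q)>|m-n|$ and $\Lambda(\mathcal Q)\setminus\{0\}$ otherwise. Theorem. The equation $AXB+CX^\star D=E$ has exactly one solution $X\in\mathbb C^{m\times n}$ for every $E\in\mathbb C^{p\times q}$ if and only if $\mathcal Q(\lambda)$ is regular and one of the following holds: 1. $p=m\ne n=q$, either $m>n$ and $B$ is invertible or $m<n$ and $A$ is invertible,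 and $\widehat\Lambda(\mathcal Q)$ is admissible; 2. $p=n\ne m=q$, either $m>n$ and $C$ is invertible or $m<n$ and $D$ is invertible, and $\widetilde\Lambda(\mathcal Q)$ is admissible; 3. $p=m=n=q$ and $\Lambda(\mathcal Q)$ is admissible. -/

import Mathlib

open scoped Matrix

noncomputable section

namespace StarSylvester

/-- The operation `⋆`: either the transpose `⊤` or the conjugate transpose `*`. -/
inductive StarKind where
  | transpose
  | conjTranspose

/-- The matrix `M^⋆`. -/
def StarKind.app {a b : ℕ} (s : StarKind) (M : Matrix (Fin a) (Fin b) ℂ) :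
    Matrix (Fin b) (Fin a) ℂ :=
  match s with
  | .transpose => Mᵀ
  | .conjTranspose => Mᴴ

/-- A (possibly rectangular) matrix is invertible if it has a two-sided inverse; over `ℂ` this
forces it to be square. -/
def IsInvertible {a b : ℕ} (M : Matrix (Fin a) (Fin b) ℂ) : Prop :=
  ∃ N : Matrix (Fin b) (Fin a) ℂ, M * N = 1 ∧ N * M = 1

/-- A matrix pencil `P(λ) = λ M + N` with `M = lead` and `N = const`, of size `r × s`. -/
structure Pencil (r s : ℕ) where
  lead : Matrix (Fin r) (Fin s) ℂ
  const : Matrix (Fin r) (Fin s) ℂ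

namespace Pencil

variable {r s : ℕ}

/-- The pencil as a matrix with polynomial entries. -/
def toPolyMatrix (P : Pencil r s) : Matrix (Fin r) (Fin s) (Polynomial ℂ) :=
  fun i j => Polynomial.X * Polynomial.C (P.lead i j) + Polynomial.C (P.const i j)

/-- The determinant of a square pencil, a polynomial in `λ` (and `0` for a rectangular one). -/
def det (P : Pencil r s) : Polynomial ℂ :=
  if h : r = s then (P.toPolyMatrix.submatrix id (Fin.cast h)).det else 0

/-- A pencil is singular if it is rectangular or its determinant vanishes identically. -/
def IsSingular (P : Pencil r s) : Prop := r ≠ s ∨ P.det = 0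

/-- A pencil is regular if it is not singular. -/
def IsRegular (P : Pencil r s) : Prop := ¬ P.IsSingular

/-- The reversal pencil `λ N + M`. -/
def rev (P : Pencil r s) : Pencil r s := ⟨P.const, P.lead⟩

/-- The spectrum of a regular pencil, in `ℂ ∪ {∞}`: the roots of its determinant, and `∞` if the
degree of the determinant is less than the size. -/
def spectrum (P : Pencil r s) : Set (OnePoint ℂ) :=
  {z | (∃ w : ℂ, z = (w : OnePoint ℂ) ∧ P.det.IsRoot w) ∨
    (z = OnePoint.infty ∧ P.det.natDegree < r)}

/-- The algebraic multiplicity `m_z(P)`; the multiplicity of `∞` is that of `0` in the reversal. -/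
def mult (P : Pencil r s) : OnePoint ℂ → ℕ
  | none => P.rev.det.rootMultiplicity 0
  | some w => P.det.rootMultiplicity w

open Classical in
/-- The spectrum with `z` removed if the multiplicity of `z` does not exceed `d`. -/
def coreSpectrum (P : Pencil r s) (z : OnePoint ℂ) (d : ℕ) : Set (OnePoint ℂ) :=
  if d < P.mult z then P.spectrum else P.spectrum \ {z}

end Pencil

/-- The inverse on `ℂ ∪ {∞}`, with `0⁻¹ = ∞` and `∞⁻¹ = 0`. -/
def recip : OnePoint ℂ → OnePoint ℂ
  | none => ((0 : ℂ) : OnePoint ℂ)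
  | some w => if w = 0 then OnePoint.infty else ((w⁻¹ : ℂ) : OnePoint ℂ)

/-- Complex conjugation on `ℂ ∪ {∞}`, fixing `∞`. -/
def conj : OnePoint ℂ → OnePoint ℂ
  | none => OnePoint.infty
  | some w => ((starRingEnd ℂ w : ℂ) : OnePoint ℂ)

/-- `S` is reciprocal free: `z ≠ w⁻¹` for all `z, w ∈ S` (possibly equal). -/
def ReciprocalFree (S : Set (OnePoint ℂ)) : Prop :=
  ∀ z ∈ S, ∀ w ∈ S, z ≠ recip w

/-- `S` is `*`-reciprocal free: `z ≠ (conj w)⁻¹` for all `z, w ∈ S` (possibly equal). -/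
def StarReciprocalFree (S : Set (OnePoint ℂ)) : Prop :=
  ∀ z ∈ S, ∀ w ∈ S, z ≠ recip (conj w)

/-- The spectral condition on a pencil `P` and a subset `S` of its spectrum: for `⋆ = ⊤`, the set
`S \ {1, -1}` is reciprocal free and `m₁(P) = m₋₁(P) ≤ 1`; for `⋆ = *`, the set `S` is
`*`-reciprocal free. -/
def SpectralCondition {r s : ℕ} (k : StarKind) (P : Pencil r s) (S : Set (OnePoint ℂ)) : Prop :=
  match k with
  | .transpose =>
      ReciprocalFree (S \ {((1 : ℂ) : OnePoint ℂ), ((-1 : ℂ) : OnePoint ℂ)}) ∧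
        P.mult ((1 : ℂ) : OnePoint ℂ) = P.mult ((-1 : ℂ) : OnePoint ℂ) ∧
        P.mult ((-1 : ℂ) : OnePoint ℂ) ≤ 1
  | .conjTranspose => StarReciprocalFree S

/-- The pencil `Q(λ) = [λ D^⋆, B^⋆; A, λ C]`, of size `(q + p) × (m + n)`. -/
def pencilQ {p m n q : ℕ} (k : StarKind) (A : Matrix (Fin p) (Fin m) ℂ)
    (B : Matrix (Fin n) (Fin q) ℂ) (C : Matrix (Fin p) (Fin n) ℂ)
    (D : Matrix (Fin m) (Fin q) ℂ) : Pencil (q + p) (m + n) where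
  lead := Matrix.reindex finSumFinEquiv finSumFinEquiv (Matrix.fromBlocks (k.app D) 0 0 C)
  const := Matrix.reindex finSumFinEquiv finSumFinEquiv (Matrix.fromBlocks 0 (k.app B) A 0)

/-- The set `Λ̂(Q)`: the spectrum, without `∞` if `m_∞(Q) = |m - n|`. -/
def hatSpectrum {r s : ℕ} (Q : Pencil r s) (m n : ℕ) : Set (OnePoint ℂ) :=
  Q.coreSpectrum OnePoint.infty ((m : ℤ) - (n : ℤ)).natAbs

/-- The set `Λ̃(Q)`: the spectrum, without `0` if `m_0(Q) = |m - n|`. -/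
def tildeSpectrum {r s : ℕ} (Q : Pencil r s) (m n : ℕ) : Set (OnePoint ℂ) :=
  Q.coreSpectrum ((0 : ℂ) : OnePoint ℂ) ((m : ℤ) - (n : ℤ)).natAbs

end StarSylvester

end

noncomputable section

namespace StarSylvester

/-! Replacing `B`, `D` by their stars, unique solvability becomes bijectivity of the real-linear
operator `op`, X ↦ A X B^⋆ + C X^⋆ D^⋆. In this form a change of bases turns (A, B, C, D) into (P A
U, R B V, P C V, R D U). The same matrices act on the homogeneous pencil [x D, y B; y A, x C] and
change its determinant only by a nonzero constant. Operator and spectrum can therefore be read off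
one common normal form.

In the square case the periodic Schur form (`exists_triangularization`) makes all four matrices
upper triangular. Put a_i = A_ii B_ii and c_i = C_ii D_ii. The determinant becomes ∏ (c_i x² - a_i
y²), so the eigenvalues are the square roots of the projective points (a_i : c_i). The operator
becomes triangular along antidiagonals, with a 2×2 system for each pair of positions (i,j), (j,i)
and a scalar equation at each (i,i) (`triangular_op_bijective_iff`). With σ the identity or
conjugation, the 2×2 systems are nonsingular iff a_i σ(a_j) ≠ c_i σ(c_j), that is, no square root of
pair i is the (conjugate) reciprocal of one of pair j. For ⊤ the scalar equation only needs a_i +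
c_i ≠ 0, so a_i = c_i may occur once: this is the exception made for ±1 (`spectralCondition_iff`).

Rank-one kernel vectors, rank-one functionals killing the range and a dimension count restrict the
sizes (`card_eq_of_bijective`). In the rectangular case `exists_pairs` splits off d = |m - n| kernel
vectors of `D`, which leaves a square problem and a factor y^d. When p = m these are d forced
infinite eigenvalues. When p = n, exchanging X with X^⋆ exchanges x with y, and they become forced
zeros. -/

/-- The scalar ring homomorphism that `⋆` applies to the entries. -/
def StarKind.hom : StarKind → ℂ →+* ℂ
  | .transpose => RingHom.id ℂ
  | .conjTranspose => starRingEnd ℂ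

@[simp] lemma StarKind.hom_hom (k : StarKind) (z : ℂ) : k.hom (k.hom z) = z := by
  cases k <;> simp [StarKind.hom]

@[simp] lemma StarKind.hom_ofReal (k : StarKind) (r : ℝ) : k.hom (r : ℂ) = r := by
  cases k <;> simp [StarKind.hom]

/-! ### The operator, its symmetries, rank-one obstructions and admissible sizes. -/

section General

variable {ι κ μ ν ι' κ' μ' ν' : Type*}

/-- The operation `⋆` on matrices with arbitrary index types. -/
def st (k : StarKind) (M : Matrix ι κ ℂ) : Matrix κ ι ℂ := Mᵀ.map k.hom

lemma app_eq_st {a b : ℕ} (k : StarKind) (M : Matrix (Fin a) (Fin b) ℂ) : k.app M = st k M := by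
  cases k <;> rfl

@[simp] lemma st_apply (k : StarKind) (M : Matrix ι κ ℂ) (i : κ) (j : ι) :
    st k M i j = k.hom (M j i) := rfl

@[simp] lemma st_st (k : StarKind) (M : Matrix ι κ ℂ) : st k (st k M) = M := by
  ext; simp

lemma st_bijective (k : StarKind) : Function.Bijective (st k : Matrix ι κ ℂ → Matrix κ ι ℂ) :=
  Function.bijective_iff_has_inverse.2 ⟨st k, st_st k, st_st k⟩

@[simp] lemma st_add (k : StarKind) (M N : Matrix ι κ ℂ) : st k (M + N) = st k M + st k N := by
  ext; simp

@[simp] lemma st_one [DecidableEq ι] (k : StarKind) : st k (1 : Matrix ι ι ℂ) = 1 := by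
  ext i j
  simp [Matrix.one_apply, eq_comm, apply_ite k.hom]

lemma st_smul (k : StarKind) (r : ℝ) (M : Matrix ι κ ℂ) : st k (r • M) = r • st k M := by
  ext; simp

lemma st_mul [Fintype κ] (k : StarKind) (M : Matrix ι κ ℂ) (N : Matrix κ μ ℂ) :
    st k (M * N) = st k N * st k M := by
  ext i j
  simp [Matrix.mul_apply, mul_comm]

/-- `P` is invertible with inverse `P'`, for possibly different index types. -/
def Inverses [Fintype ι] [Fintype κ] [DecidableEq ι] [DecidableEq κ]
    (P : Matrix ι κ ℂ) (P' : Matrix κ ι ℂ) : Prop := P * P' = 1 ∧ P' * P = 1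

/-- The operator `X ↦ A X B^⋆ + C X^⋆ D^⋆`. -/
def op [Fintype μ] [Fintype ν] (k : StarKind) (A : Matrix ι μ ℂ) (B : Matrix κ ν ℂ)
    (C : Matrix ι ν ℂ) (D : Matrix κ μ ℂ) (X : Matrix μ ν ℂ) : Matrix ι κ ℂ :=
  A * X * st k B + C * st k X * st k D

/-- `op` as a real linear map. -/
def opLin [Fintype μ] [Fintype ν] (k : StarKind) (A : Matrix ι μ ℂ) (B : Matrix κ ν ℂ)
    (C : Matrix ι ν ℂ) (D : Matrix κ μ ℂ) : Matrix μ ν ℂ →ₗ[ℝ] Matrix ι κ ℂ where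
  toFun := op k A B C D
  map_add' X Y := by simp only [op, st_add, Matrix.mul_add, Matrix.add_mul]; abel
  map_smul' r X := by simp [op, st_smul]

section Symmetries

variable [Fintype μ] [Fintype ν]
variable (k : StarKind) (A : Matrix ι μ ℂ) (B : Matrix κ ν ℂ) (C : Matrix ι ν ℂ) (D : Matrix κ μ ℂ)

lemma op_swap_bijective :
    Function.Bijective (op k C D A B) ↔ Function.Bijective (op k A B C D) := by
  have : op k A B C D = op k C D A B ∘ st k := by
    funext X; simp [op, add_comm]
  rw [this, Function.Bijective.of_comp_iff _ (st_bijective k)]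

lemma op_star_bijective :
    Function.Bijective (op k B A D C) ↔ Function.Bijective (op k A B C D) := by
  have : st k ∘ op k A B C D = op k B A D C ∘ st k := by
    funext X; simp [op, st_mul, Matrix.mul_assoc]
  rw [← Function.Bijective.of_comp_iff _ (st_bijective k), ← this,
    Function.Bijective.of_comp_iff' (st_bijective k)]

end Symmetries

section Equivalence

variable [Fintype μ] [Fintype ν] [Fintype ι] [Fintype κ] [Fintype μ'] [Fintype ν'] [Fintype ι']
  [Fintype κ'] [DecidableEq μ] [DecidableEq ν] [DecidableEq ι] [DecidableEq κ] [DecidableEq μ']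
  [DecidableEq ν'] [DecidableEq ι'] [DecidableEq κ']

lemma Inverses.symm {P : Matrix ι κ ℂ} {P' : Matrix κ ι ℂ} (h : Inverses P P') :
    Inverses P' P := ⟨h.2, h.1⟩

lemma Inverses.st (k : StarKind) {P : Matrix ι κ ℂ} {P' : Matrix κ ι ℂ} (h : Inverses P P') :
    Inverses (st k P) (st k P') := by
  constructor
  · rw [← st_mul, h.2, st_one]
  · rw [← st_mul, h.1, st_one]

lemma Inverses.mul_left_bijective {P : Matrix ι κ ℂ} {P' : Matrix κ ι ℂ} (h : Inverses P P')
    (μ : Type*) : Function.Bijective (fun X : Matrix κ μ ℂ => P * X) :=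
  Function.bijective_iff_has_inverse.2 ⟨fun X => P' * X,
    fun X => by simp [← Matrix.mul_assoc, h.2], fun X => by simp [← Matrix.mul_assoc, h.1]⟩

lemma Inverses.mul_right_bijective {P : Matrix ι κ ℂ} {P' : Matrix κ ι ℂ} (h : Inverses P P')
    (μ : Type*) : Function.Bijective (fun X : Matrix μ ι ℂ => X * P) :=
  Function.bijective_iff_has_inverse.2 ⟨fun X => X * P',
    fun X => by simp [Matrix.mul_assoc, h.1], fun X => by simp [Matrix.mul_assoc, h.2]⟩

/-- The new operator is the old one composed with X ↦ U X V^⋆ before and E ↦ P E R^⋆ after. -/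
lemma op_equiv_bijective (k : StarKind) (A : Matrix ι μ ℂ) (B : Matrix κ ν ℂ) (C : Matrix ι ν ℂ)
    (D : Matrix κ μ ℂ) {P : Matrix ι' ι ℂ} {P' : Matrix ι ι' ℂ} (hP : Inverses P P')
    {R : Matrix κ' κ ℂ} {R' : Matrix κ κ' ℂ} (hR : Inverses R R')
    {U : Matrix μ μ' ℂ} {U' : Matrix μ' μ ℂ} (hU : Inverses U U')
    {V : Matrix ν ν' ℂ} {V' : Matrix ν' ν ℂ} (hV : Inverses V V') :
    Function.Bijective (op k (P * A * U) (R * B * V) (P * C * V) (R * D * U)) ↔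
      Function.Bijective (op k A B C D) := by
  have h : op k (P * A * U) (R * B * V) (P * C * V) (R * D * U) =
      (fun X => P * X) ∘ (fun X => X * st k R) ∘ op k A B C D ∘ (fun X => X * st k V) ∘
        (fun X => U * X) := by
    funext X
    simp [op, st_mul, Matrix.mul_assoc, Matrix.mul_add, Matrix.add_mul]
  rw [h, Function.Bijective.of_comp_iff' (hP.mul_left_bijective _),
    Function.Bijective.of_comp_iff' ((hR.st k).mul_right_bijective _),
    Function.Bijective.of_comp_iff _
      (((hV.st k).mul_right_bijective _).comp (hU.mul_left_bijective _))]

end Equivalence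

section Kernels

variable {k : StarKind}

/-- The rank one matrix `u w^⋆`. -/
def rankOne (k : StarKind) (u : μ → ℂ) (w : ν → ℂ) : Matrix μ ν ℂ :=
  Matrix.of fun i j => u i * k.hom (w j)

lemma rankOne_ne_zero {u : μ → ℂ} {w : ν → ℂ} (hu : u ≠ 0) (hw : w ≠ 0) :
    rankOne k u w ≠ 0 := by
  obtain ⟨i, hi⟩ := Function.ne_iff.1 hu
  obtain ⟨j, hj⟩ := Function.ne_iff.1 hw
  intro h
  have := congrFun (congrFun h i) j
  simp_all [rankOne]

lemma mul_rankOne [Fintype μ] (M : Matrix ι μ ℂ) (u : μ → ℂ) (w : ν → ℂ) :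
    M * rankOne k u w = rankOne k (M *ᵥ u) w := by
  ext i j
  simp [rankOne, Matrix.mul_apply, Matrix.mulVec, dotProduct, Finset.sum_mul, mul_assoc]

lemma st_rankOne (u : μ → ℂ) (w : ν → ℂ) : st k (rankOne k u w) = rankOne k w u := by
  ext i j
  simp [rankOne, mul_comm]

lemma rankOne_mul_st [Fintype ν] (M : Matrix κ ν ℂ) (u : μ → ℂ) (w : ν → ℂ) :
    rankOne k u w * st k M = rankOne k u (M *ᵥ w) := by
  have := congrArg (st k) (mul_rankOne (k := k) M w u)
  rwa [st_mul, st_rankOne, st_rankOne] at this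

@[simp] lemma rankOne_zero_left (w : ν → ℂ) : rankOne k (0 : μ → ℂ) w = 0 := by
  ext; simp [rankOne]

@[simp] lemma rankOne_zero_right (u : μ → ℂ) : rankOne k u (0 : ν → ℂ) = 0 := by
  ext; simp [rankOne]

variable [Fintype μ] [Fintype ν] {A : Matrix ι μ ℂ} {B : Matrix κ ν ℂ}
  {C : Matrix ι ν ℂ} {D : Matrix κ μ ℂ}

/-- Each summand stays of rank one, so a kernel vector in each summand's factors already yields a
nonzero kernel element of the operator. -/
lemma op_rankOne (u : μ → ℂ) (w : ν → ℂ) : op k A B C D (rankOne k u w) =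
    rankOne k (A *ᵥ u) (B *ᵥ w) + rankOne k (C *ᵥ w) (D *ᵥ u) := by
  simp [op, mul_rankOne, rankOne_mul_st, st_rankOne]

lemma not_injective_of_op_eq_zero {X : Matrix μ ν ℂ} (hX : X ≠ 0) (h : op k A B C D X = 0) :
    ¬ Function.Injective (op k A B C D) := by
  intro hi
  exact hX (hi (h.trans (map_zero (opLin k A B C D)).symm))

lemma not_injective_of_kernel_BD {u : μ → ℂ} {w : ν → ℂ} (hu : u ≠ 0) (hw : w ≠ 0)
    (hD : D *ᵥ u = 0) (hB : B *ᵥ w = 0) : ¬ Function.Injective (op k A B C D) :=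
  not_injective_of_op_eq_zero (rankOne_ne_zero (k := k) hu hw) (by simp [op_rankOne, hD, hB])

lemma not_injective_of_kernel_AC {u : μ → ℂ} {w : ν → ℂ} (hu : u ≠ 0) (hw : w ≠ 0)
    (hA : A *ᵥ u = 0) (hC : C *ᵥ w = 0) : ¬ Function.Injective (op k A B C D) :=
  not_injective_of_op_eq_zero (rankOne_ne_zero (k := k) hu hw) (by simp [op_rankOne, hA, hC])

lemma not_injective_of_kernel_AD {u : μ → ℂ} {w : ν → ℂ} (hu : u ≠ 0) (hw : w ≠ 0)
    (hA : A *ᵥ u = 0) (hD : D *ᵥ u = 0) : ¬ Function.Injective (op k A B C D) :=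
  not_injective_of_op_eq_zero (rankOne_ne_zero (k := k) hu hw) (by simp [op_rankOne, hA, hD])

/-- The functional E ↦ u E v^⋆ is nonzero: test it on a matrix unit at a position where `u` and `v`
do not vanish. A surjective operator cannot have its range inside the kernel of this functional. -/
lemma not_surjective_of_forall [Fintype ι] [Fintype κ] {u : ι → ℂ} {v : κ → ℂ} (hu : u ≠ 0)
    (hv : v ≠ 0)
    (h : ∀ X, u ᵥ* op k A B C D X ⬝ᵥ (fun j => k.hom (v j)) = 0) :
    ¬ Function.Surjective (op k A B C D) := by
  classical
  intro hs
  obtain ⟨i, hi⟩ := Function.ne_iff.1 hu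
  obtain ⟨j, hj⟩ := Function.ne_iff.1 hv
  obtain ⟨X, hX⟩ := hs (Matrix.single i j 1)
  have := h X
  rw [hX] at this
  simp only [Matrix.vecMul, dotProduct, Matrix.single_apply, mul_ite, mul_one, mul_zero] at this
  simp_all [ite_and]

lemma vecMul_st_dotProduct [Fintype κ] (x : ν → ℂ) (v : κ → ℂ) (M : Matrix κ ν ℂ)
    (h : v ᵥ* M = 0) : x ᵥ* st k M ⬝ᵥ (fun j => k.hom (v j)) = 0 := by
  rw [← Matrix.dotProduct_mulVec]
  have : st k M *ᵥ (fun j => k.hom (v j)) = 0 := by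
    funext i
    have := congrArg k.hom (congrFun h i)
    simpa [Matrix.mulVec, Matrix.vecMul, dotProduct, mul_comm] using this
  simp [this]

lemma not_surjective_of_cokernel_AD [Fintype ι] [Fintype κ] {u : ι → ℂ} {v : κ → ℂ} (hu : u ≠ 0)
    (hv : v ≠ 0) (hA : u ᵥ* A = 0) (hD : v ᵥ* D = 0) :
    ¬ Function.Surjective (op k A B C D) :=
  not_surjective_of_forall hu hv fun X => by
    rw [op, Matrix.vecMul_add, add_dotProduct, ← Matrix.vecMul_vecMul (M := C * st k X),
      vecMul_st_dotProduct _ _ _ hD]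
    simp [← Matrix.vecMul_vecMul, hA]

lemma not_surjective_of_cokernel_BC [Fintype ι] [Fintype κ] {u : ι → ℂ} {v : κ → ℂ} (hu : u ≠ 0)
    (hv : v ≠ 0) (hC : u ᵥ* C = 0) (hB : v ᵥ* B = 0) :
    ¬ Function.Surjective (op k A B C D) :=
  not_surjective_of_forall hu hv fun X => by
    rw [op, Matrix.vecMul_add, add_dotProduct, ← Matrix.vecMul_vecMul (M := A * X),
      vecMul_st_dotProduct _ _ _ hB]
    simp [← Matrix.vecMul_vecMul, hC]

end Kernels

/-- A wide matrix has a nonzero kernel vector. -/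
lemma exists_mulVec_eq_zero_of_card_lt [Fintype ι] [Fintype κ] (M : Matrix ι κ ℂ)
    (h : Fintype.card ι < Fintype.card κ) : ∃ u, u ≠ 0 ∧ M *ᵥ u = 0 := by
  have : ¬ Function.Injective M.mulVecLin := fun hi => by
    have := LinearMap.finrank_le_finrank_of_injective hi
    simp at this; omega
  rw [← LinearMap.ker_eq_bot, Submodule.eq_bot_iff] at this
  push Not at this
  obtain ⟨u, hu, h0⟩ := this
  exact ⟨u, h0, by simpa using hu⟩

lemma exists_vecMul_eq_zero_of_card_lt [Fintype ι] [Fintype κ] (M : Matrix ι κ ℂ)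
    (h : Fintype.card κ < Fintype.card ι) : ∃ u, u ≠ 0 ∧ u ᵥ* M = 0 := by
  obtain ⟨u, h0, hu⟩ := exists_mulVec_eq_zero_of_card_lt Mᵀ h
  exact ⟨u, h0, by rwa [Matrix.mulVec_transpose] at hu⟩

/-- A bijective operator forces the two sizes to agree up to order. -/
lemma card_eq_of_bijective {p m n q : ℕ} (hm : 0 < m) (hn : 0 < n) {k : StarKind}
    {A : Matrix (Fin p) (Fin m) ℂ} {B : Matrix (Fin q) (Fin n) ℂ} {C : Matrix (Fin p) (Fin n) ℂ}
    {D : Matrix (Fin q) (Fin m) ℂ} (h : Function.Bijective (op k A B C D)) :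
    (p = m ∧ n = q) ∨ (p = n ∧ m = q) := by
  -- Dimensions are counted over ℝ, since for the conjugate transpose the operator is not complex
  -- linear.
  have h1 : m * n = p * q := by
    have := (LinearEquiv.ofBijective (opLin k A B C D) h).finrank_eq
    simp only [Module.finrank_matrix, Fintype.card_fin, Complex.finrank_real_complex] at this
    omega
  have h2 : ¬ (q < m ∧ q < n) := fun ⟨hqm, hqn⟩ => by
    obtain ⟨u, hu, hu'⟩ := exists_mulVec_eq_zero_of_card_lt D (by simpa)
    obtain ⟨w, hw, hw'⟩ := exists_mulVec_eq_zero_of_card_lt B (by simpa)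
    exact not_injective_of_kernel_BD hu hw hu' hw' h.1
  have h3 : ¬ (p < m ∧ p < n) := fun ⟨hqm, hqn⟩ => by
    obtain ⟨u, hu, hu'⟩ := exists_mulVec_eq_zero_of_card_lt A (by simpa)
    obtain ⟨w, hw, hw'⟩ := exists_mulVec_eq_zero_of_card_lt C (by simpa)
    exact not_injective_of_kernel_AC hu hw hu' hw' h.1
  have h4 : ¬ (m < p ∧ m < q) := fun ⟨hqm, hqn⟩ => by
    obtain ⟨u, hu, hu'⟩ := exists_vecMul_eq_zero_of_card_lt A (by simpa)
    obtain ⟨w, hw, hw'⟩ := exists_vecMul_eq_zero_of_card_lt D (by simpa)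
    exact not_surjective_of_cokernel_AD hu hw hu' hw' h.2
  have h5 : ¬ (n < p ∧ n < q) := fun ⟨hqm, hqn⟩ => by
    obtain ⟨u, hu, hu'⟩ := exists_vecMul_eq_zero_of_card_lt C (by simpa)
    obtain ⟨w, hw, hw'⟩ := exists_vecMul_eq_zero_of_card_lt B (by simpa)
    exact not_surjective_of_cokernel_BC hu hw hu' hw' h.2
  -- The four exclusions say min(p, q) = min(m, n). The dimension count then identifies the two
  -- remaining sizes.
  have h6 : p = m ∨ p = n ∨ q = m ∨ q = n := by omega
  rcases h6 with rfl | rfl | rfl | rfl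
  · exact Or.inl ⟨rfl, Nat.eq_of_mul_eq_mul_left hm h1⟩
  · exact Or.inr ⟨rfl, Nat.eq_of_mul_eq_mul_left hn (by linarith)⟩
  · exact Or.inr ⟨Nat.eq_of_mul_eq_mul_left hm (by linarith), rfl⟩
  · exact Or.inl ⟨Nat.eq_of_mul_eq_mul_right hn (by linarith), rfl⟩

end General

/-! ### Completing independent columns to invertible matrices. -/

section Completion

variable {ι κ μ ι' κ' : Type*} [Fintype ι] [Fintype κ] [Fintype μ] [DecidableEq ι] [DecidableEq κ]
  [DecidableEq μ] [Fintype ι'] [Fintype κ'] [DecidableEq ι'] [DecidableEq κ']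

lemma Inverses.mul {P : Matrix ι κ ℂ} {P' : Matrix κ ι ℂ} {R : Matrix κ μ ℂ} {R' : Matrix μ κ ℂ}
    (h : Inverses P P') (g : Inverses R R') : Inverses (P * R) (R' * P') := by
  constructor
  · rw [Matrix.mul_assoc, ← Matrix.mul_assoc R, g.1, Matrix.one_mul, h.1]
  · rw [Matrix.mul_assoc, ← Matrix.mul_assoc P', h.2, Matrix.one_mul, g.2]

lemma Inverses.fromBlocks {P : Matrix ι κ ℂ} {P' : Matrix κ ι ℂ} {R : Matrix ι' κ' ℂ}
    {R' : Matrix κ' ι' ℂ} (h : Inverses P P') (g : Inverses R R') :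
    Inverses (Matrix.fromBlocks P 0 0 R) (Matrix.fromBlocks P' 0 0 R') := by
  simp [Inverses, Matrix.fromBlocks_multiply, h.1, h.2, g.1, g.2]

lemma Inverses.one : Inverses (1 : Matrix ι ι ℂ) 1 := by simp [Inverses]

lemma Inverses.submatrix {P : Matrix ι κ ℂ} {P' : Matrix κ ι ℂ} (h : Inverses P P')
    (e : ι' ≃ ι) (f : κ' ≃ κ) : Inverses (P.submatrix e f) (P'.submatrix f e) := by
  simp [Inverses, Matrix.submatrix_mul_equiv, h.1, h.2]

/-- Linearly independent columns can be completed to an invertible matrix. -/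
lemma exists_inverses_extending (hc : Fintype.card μ = Fintype.card ι + Fintype.card κ)
    (M : Matrix μ κ ℂ) (hM : Function.Injective M.mulVec) :
    ∃ (U : Matrix μ (ι ⊕ κ) ℂ) (U' : Matrix (ι ⊕ κ) μ ℂ), Inverses U U' ∧
      ∀ i j, U i (Sum.inr j) = M i j := by
  have hM' : Function.Injective M.mulVecLin := hM
  obtain ⟨S, hS⟩ := Submodule.exists_isCompl (LinearMap.range M.mulVecLin)
  have h1 : Module.finrank ℂ (LinearMap.range M.mulVecLin) = Fintype.card κ := by
    rw [LinearMap.finrank_range_of_inj hM']; simp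
  have h2 : Module.finrank ℂ (ι → ℂ) = Module.finrank ℂ S := by
    have := Submodule.finrank_add_eq_of_isCompl hS
    simp at this ⊢; omega
  let e : (ι ⊕ κ → ℂ) ≃ₗ[ℂ] (μ → ℂ) :=
    (LinearEquiv.sumArrowLequivProdArrow ι κ ℂ ℂ).trans
      (((LinearEquiv.ofFinrankEq _ _ h2).prodCongr (LinearEquiv.ofInjective _ hM')).trans
        (Submodule.prodEquivOfIsCompl _ _ hS.symm))
  refine ⟨LinearMap.toMatrix' e.toLinearMap, LinearMap.toMatrix' e.symm.toLinearMap, ⟨?_, ?_⟩, ?_⟩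
  · rw [← LinearMap.toMatrix'_comp]; simp
  · rw [← LinearMap.toMatrix'_comp]; simp
  · intro i j
    have h3 : LinearEquiv.sumArrowLequivProdArrow ι κ ℂ ℂ (Pi.single (Sum.inr j) 1) =
        (0, Pi.single j 1) := by
      ext <;> simp [Pi.single_apply]
    simp [LinearMap.toMatrix'_apply, e, h3]

/-- A nonzero vector is the last column of an invertible matrix. -/
lemma exists_inverses_column (hc : Fintype.card μ = Fintype.card ι + 1)
    {u : μ → ℂ} (hu : u ≠ 0) :
    ∃ (U : Matrix μ (ι ⊕ Unit) ℂ) (U' : Matrix (ι ⊕ Unit) μ ℂ), Inverses U U' ∧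
      U *ᵥ Pi.single (Sum.inr ()) 1 = u := by
  obtain ⟨U, U', h, hU⟩ := exists_inverses_extending (ι := ι) (κ := Unit) (by simpa using hc)
    (Matrix.of fun i _ => u i) (by
      intro x y hxy
      obtain ⟨i, hi⟩ := Function.ne_iff.1 hu
      have := congrFun hxy i
      funext j
      simp_all [Matrix.mulVec, dotProduct])
  refine ⟨U, U', h, ?_⟩
  funext i
  simp [hU]

end Completion

/-! ### The periodic Schur form of four square matrices. -/

section Triangularization

lemma exists_kernel_of_not_isUnit {ι : Type*} [Fintype ι] [DecidableEq ι] {A : Matrix ι ι ℂ}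
    (h : ¬ IsUnit A.det) : ∃ u, u ≠ 0 ∧ A *ᵥ u = 0 :=
  Matrix.exists_mulVec_eq_zero_iff.2 (by simpa using h)

lemma exists_line {ι : Type*} [Nonempty ι] (x : ι → ℂ) :
    ∃ p : ι → ℂ, p ≠ 0 ∧ ∃ c : ℂ, x = c • p := by
  by_cases hx : x = 0
  · exact ⟨1, one_ne_zero, 0, by simp [hx]⟩
  · exact ⟨x, hx, 1, by simp⟩

variable {ι : Type*} [Fintype ι]

/-- `u` and `v` span a deflating pair of lines: `A u ∥ C v` and `D u ∥ B v`. -/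
def Deflating (A B C D : Matrix ι ι ℂ) : Prop :=
  ∃ u v p r : ι → ℂ, u ≠ 0 ∧ v ≠ 0 ∧ p ≠ 0 ∧ r ≠ 0 ∧ (∃ a : ℂ, A *ᵥ u = a • p) ∧
    (∃ b : ℂ, B *ᵥ v = b • r) ∧ (∃ c : ℂ, C *ᵥ v = c • p) ∧ ∃ d : ℂ, D *ᵥ u = d • r

lemma Deflating.swap {A B C D : Matrix ι ι ℂ} (h : Deflating C D A B) : Deflating A B C D := by
  obtain ⟨u, v, p, r, hu, hv, hp, hr, h1, h2, h3, h4⟩ := h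
  exact ⟨v, u, p, r, hv, hu, hp, hr, h3, h4, h1, h2⟩

lemma Deflating.star {A B C D : Matrix ι ι ℂ} (h : Deflating B A D C) : Deflating A B C D := by
  obtain ⟨u, v, p, r, hu, hv, hp, hr, h1, h2, h3, h4⟩ := h
  exact ⟨v, u, r, p, hv, hu, hr, hp, h2, h1, h4, h3⟩

lemma isUnit_det_mulVec_inv [DecidableEq ι] {A : Matrix ι ι ℂ} (h : IsUnit A.det) (x : ι → ℂ) :
    A *ᵥ (A⁻¹ *ᵥ x) = x := by
  rw [Matrix.mulVec_mulVec, Matrix.mul_nonsing_inv _ h, Matrix.one_mulVec]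

/-- With `u` in the kernel of `A`, the condition on A u holds for every line, so the cycle of
conditions is cut open. One follows it from u through D, backwards through B, then through C,
choosing a line at each stage. -/
lemma deflating_of_singular [DecidableEq ι] [Nonempty ι] {A : Matrix ι ι ℂ}
    (h : ¬ IsUnit A.det) (B C D : Matrix ι ι ℂ) :
    Deflating A B C D := by
  obtain ⟨u, hu, hAu⟩ := exists_kernel_of_not_isUnit h
  obtain ⟨r, hr, d, hd⟩ := exists_line (D *ᵥ u)
  have : ∃ v, v ≠ 0 ∧ ∃ b : ℂ, B *ᵥ v = b • r := by
    by_cases hB : IsUnit B.det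
    · refine ⟨B⁻¹ *ᵥ r, fun h0 => hr ?_, 1, ?_⟩
      · rw [← isUnit_det_mulVec_inv hB r, h0, Matrix.mulVec_zero]
      · rw [isUnit_det_mulVec_inv hB, one_smul]
    · obtain ⟨v, hv, h0⟩ := exists_kernel_of_not_isUnit hB
      exact ⟨v, hv, 0, by simp [h0]⟩
  obtain ⟨v, hv, hb⟩ := this
  obtain ⟨p, hp, hc⟩ := exists_line (C *ᵥ v)
  exact ⟨u, v, p, r, hu, hv, hp, hr, ⟨0, by simp [hAu]⟩, hb, hc, d, hd⟩

/-- The symmetries reduce any singular coefficient to the previous case. If all four are invertible,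
going once around the cycle gives A⁻¹ C B⁻¹ D, and any eigenvector of it closes up. -/
lemma deflating [DecidableEq ι] [Nonempty ι] (A B C D : Matrix ι ι ℂ) : Deflating A B C D := by
  by_cases hA : IsUnit A.det
  swap; · exact deflating_of_singular hA _ _ _
  by_cases hB : IsUnit B.det
  swap; · exact (deflating_of_singular hB _ _ _).star
  by_cases hC : IsUnit C.det
  swap; · exact (deflating_of_singular hC _ _ _).swap
  by_cases hD : IsUnit D.det
  swap; · exact ((deflating_of_singular hD _ _ _).swap).star
  obtain ⟨μ, hμ⟩ := Module.End.exists_eigenvalue (Matrix.toLin' (A⁻¹ * C * B⁻¹ * D))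
  obtain ⟨u, hu⟩ := hμ.exists_hasEigenvector
  have hDu : D *ᵥ u ≠ 0 := fun h0 =>
    hu.2 (Matrix.mulVec_injective_iff_isUnit.2 ((Matrix.isUnit_iff_isUnit_det _).2 hD)
      (by simpa using h0))
  have hAu : A *ᵥ u ≠ 0 := fun h0 =>
    hu.2 (Matrix.mulVec_injective_iff_isUnit.2 ((Matrix.isUnit_iff_isUnit_det _).2 hA)
      (by simpa using h0))
  refine ⟨u, B⁻¹ *ᵥ (D *ᵥ u), A *ᵥ u, D *ᵥ u, hu.2, fun h0 => hDu ?_, hAu, hDu, ⟨1, by simp⟩,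
    ⟨1, ?_⟩, ⟨μ, ?_⟩, 1, by simp⟩
  · rw [← isUnit_det_mulVec_inv hB (D *ᵥ u), h0, Matrix.mulVec_zero]
  · rw [isUnit_det_mulVec_inv hB, one_smul]
  · have h1 := hu.apply_eq_smul
    rw [Matrix.toLin'_apply] at h1
    rw [← Matrix.mulVec_smul, ← h1]
    simp only [← Matrix.mulVec_mulVec]
    rw [isUnit_det_mulVec_inv hA]

/-- A matrix with a map between distinguished lines is block triangular in adapted bases. -/
lemma toBlocks₁₂_eq_zero {μ : Type*} [Fintype μ] [DecidableEq μ] {κ : Type*} [Fintype κ]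
    [DecidableEq κ] {P : Matrix (κ ⊕ Unit) μ ℂ} {P' : Matrix μ (κ ⊕ Unit) ℂ} (hP : Inverses P' P)
    {U : Matrix μ (κ ⊕ Unit) ℂ} (A : Matrix μ μ ℂ) {u p : μ → ℂ}
    (hu : U *ᵥ Pi.single (Sum.inr ()) 1 = u) (hp : P' *ᵥ Pi.single (Sum.inr ()) 1 = p)
    (h : ∃ a : ℂ, A *ᵥ u = a • p) : (P * A * U).toBlocks₁₂ = 0 := by
  obtain ⟨a, ha⟩ := h
  have : (P * A * U) *ᵥ Pi.single (Sum.inr ()) 1 = a • Pi.single (Sum.inr ()) 1 := by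
    rw [← Matrix.mulVec_mulVec, hu, ← Matrix.mulVec_mulVec, ha, Matrix.mulVec_smul, ← hp,
      Matrix.mulVec_mulVec, hP.2, Matrix.one_mulVec]
  ext i j
  have := congrFun this (Sum.inl i)
  simpa [Matrix.toBlocks₁₂] using this

/-- Bordering a triangularization of the upper left block. -/
lemma upper_triangular_bordered {n : ℕ} {M : Matrix (Fin n ⊕ Unit) (Fin n ⊕ Unit) ℂ}
    (hM : M.toBlocks₁₂ = 0) {P U : Matrix (Fin n) (Fin n) ℂ}
    (h : ∀ i j, j < i → (P * M.toBlocks₁₁ * U) i j = 0) (i j : Fin (n + 1)) (hij : j < i) :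
    ((Matrix.fromBlocks P 0 0 (1 : Matrix Unit Unit ℂ) * M * Matrix.fromBlocks U 0 0 1).submatrix
      ((finSuccEquiv n).trans (Equiv.optionEquivSumPUnit _))
      ((finSuccEquiv n).trans (Equiv.optionEquivSumPUnit _))) i j = 0 := by
  rw [← Matrix.fromBlocks_toBlocks M, hM]
  simp only [Matrix.fromBlocks_multiply]
  induction i using Fin.cases with
  | zero => simp at hij
  | succ i =>
    induction j using Fin.cases with
    | zero => simp
    | succ j => simpa using h i j (by simpa using hij)

/-- The periodic Schur form: simultaneous triangularization of a cycle of four matrices. -/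
theorem exists_triangularization (n : ℕ) (A B C D : Matrix (Fin n) (Fin n) ℂ) :
    ∃ P P' R R' U U' V V' : Matrix (Fin n) (Fin n) ℂ,
      Inverses P P' ∧ Inverses R R' ∧ Inverses U U' ∧ Inverses V V' ∧
      (∀ i j, j < i → (P * A * U) i j = 0) ∧ (∀ i j, j < i → (R * B * V) i j = 0) ∧
      (∀ i j, j < i → (P * C * V) i j = 0) ∧ (∀ i j, j < i → (R * D * U) i j = 0) := by
  induction n with
  | zero =>
    exact ⟨1, 1, 1, 1, 1, 1, 1, 1, Inverses.one, Inverses.one, Inverses.one, Inverses.one,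
      fun i => i.elim0, fun i => i.elim0, fun i => i.elim0, fun i => i.elim0⟩
  | succ n ih =>
    obtain ⟨u, v, p, r, hu, hv, hp, hr, h1, h2, h3, h4⟩ := deflating A B C D
    obtain ⟨U, U', hU, hUu⟩ := exists_inverses_column (ι := Fin n) (by simp) hu
    obtain ⟨V, V', hV, hVv⟩ := exists_inverses_column (ι := Fin n) (by simp) hv
    -- On the target side the distinguished vector is a column of `P'`, and the coefficients are
    -- multiplied by its inverse `P`.
    obtain ⟨P', P, hP, hPp⟩ := exists_inverses_column (ι := Fin n) (by simp) hp
    obtain ⟨R', R, hR, hRr⟩ := exists_inverses_column (ι := Fin n) (by simp) hr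
    have hA := toBlocks₁₂_eq_zero hP A hUu hPp h1
    have hB := toBlocks₁₂_eq_zero hR B hVv hRr h2
    have hC := toBlocks₁₂_eq_zero hP C hVv hPp h3
    have hD := toBlocks₁₂_eq_zero hR D hUu hRr h4
    obtain ⟨P₁, P₁', R₁, R₁', U₁, U₁', V₁, V₁', gP, gR, gU, gV, k1, k2, k3, k4⟩ :=
      ih (P * A * U).toBlocks₁₁ (R * B * V).toBlocks₁₁ (P * C * V).toBlocks₁₁ (R * D * U).toBlocks₁₁
    -- `e` sends index 0 to the `Unit` summand. The deflating vector thus comes first, and vanishing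
    -- of the block `toBlocks₁₂` means that the first column is zero below the diagonal.
    let e := (finSuccEquiv n).trans (Equiv.optionEquivSumPUnit (Fin n))
    have key : ∀ (P U : Matrix (Fin n ⊕ Unit) (Fin n ⊕ Unit) ℂ)
        (Q : Matrix (Fin n ⊕ Unit) (Fin (n + 1)) ℂ)
        (W : Matrix (Fin (n + 1)) (Fin n ⊕ Unit) ℂ) (A : Matrix (Fin (n + 1)) (Fin (n + 1)) ℂ),
        (P * Q).submatrix e (Equiv.refl _) * A * (W * U).submatrix (Equiv.refl _) e =
          (P * (Q * A * W) * U).submatrix e e := by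
      intro P U Q W A
      rw [show P * (Q * A * W) * U = (P * Q) * A * (W * U) by simp only [Matrix.mul_assoc]]
      rfl
    refine ⟨_, _, _, _, _, _, _, _,
      ((gP.fromBlocks Inverses.one).mul hP.symm).submatrix e (Equiv.refl _),
      ((gR.fromBlocks Inverses.one).mul hR.symm).submatrix e (Equiv.refl _),
      (hU.mul (gU.fromBlocks Inverses.one)).submatrix (Equiv.refl _) e,
      (hV.mul (gV.fromBlocks Inverses.one)).submatrix (Equiv.refl _) e, ?_, ?_, ?_, ?_⟩
    all_goals intro i j hij; rw [key]
    · exact upper_triangular_bordered hA k1 i j hij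
    · exact upper_triangular_bordered hB k2 i j hij
    · exact upper_triangular_bordered hC k3 i j hij
    · exact upper_triangular_bordered hD k4 i j hij

end Triangularization

/-! ### Solvability of the scalar equations and the 2×2 systems. -/

/-- The condition for the unique solvability of the scalar equation `a x + c x^⋆ = e`. -/
def ScalarCond (k : StarKind) (a c : ℂ) : Prop :=
  match k with
  | .transpose => a + c ≠ 0
  | .conjTranspose => a * starRingEnd ℂ a ≠ c * starRingEnd ℂ c

/-- The condition for unique solvability in terms of the eigenvalue pairs `(aᵢ : cᵢ)`. -/
def PairCond {ι : Type*} (k : StarKind) (a c : ι → ℂ) : Prop :=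
  (∀ i j, i ≠ j → a i * k.hom (a j) ≠ c i * k.hom (c j)) ∧ ∀ i, ScalarCond k (a i) (c i)

lemma ScalarCond.ne_zero {k : StarKind} {a c : ℂ} (h : ScalarCond k a c) : a ≠ 0 ∨ c ≠ 0 := by
  by_contra! h0
  cases k <;> simp [ScalarCond, h0] at h

lemma ScalarCond.symm {k : StarKind} {a c : ℂ} (h : ScalarCond k a c) : ScalarCond k c a := by
  cases k
  · simpa [ScalarCond, add_comm] using h
  · exact Ne.symm h

lemma PairCond.symm {ι : Type*} {k : StarKind} {a c : ι → ℂ} (h : PairCond k a c) :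
    PairCond k c a := ⟨fun i j hij => (h.1 i j hij).symm, fun i => (h.2 i).symm⟩

lemma pairCond_comm {ι : Type*} {k : StarKind} {a c : ι → ℂ} : PairCond k a c ↔ PairCond k c a :=
  ⟨PairCond.symm, PairCond.symm⟩

/-- For ⊤ the map is multiplication by ab + cd. For * it is x ↦ αx + βx̄ with α = a b̄ and β = c d̄,
a real-linear map that is injective iff |α| ≠ |β|. -/
lemma scalarCond_iff (k : StarKind) (a b c d : ℂ) : ScalarCond k (a * b) (c * d) ↔
    ∀ x, a * x * k.hom b + c * k.hom x * k.hom d = 0 → x = 0 := by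
  cases k with
  | transpose =>
    simp only [ScalarCond, StarKind.hom, RingHom.id_apply]
    constructor
    · intro h x hx
      have : (a * b + c * d) * x = 0 := by linear_combination hx
      simpa [h] using this
    · intro h h0
      exact one_ne_zero (h 1 (by linear_combination h0))
  | conjTranspose =>
    simp only [ScalarCond, StarKind.hom, map_mul]
    constructor
    · intro h x hx
      by_contra hx0
      have h1 := congrArg (starRingEnd ℂ) hx
      simp only [map_add, map_mul, Complex.conj_conj, map_zero] at h1
      have : (a * b * (starRingEnd ℂ a * starRingEnd ℂ b) -
          c * d * (starRingEnd ℂ c * starRingEnd ℂ d)) * (x * starRingEnd ℂ x) = 0 := by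
        linear_combination (starRingEnd ℂ a * b * starRingEnd ℂ x) * hx -
          (c * starRingEnd ℂ x * starRingEnd ℂ d) * h1
      have hx1 : starRingEnd ℂ x ≠ 0 := by simpa using hx0
      exact h (sub_eq_zero.1 (by simpa [hx0, hx1] using this))
    · intro h h0
      -- The map sends ᾱy - βȳ to (|α|² - |β|²)y = 0. Injectivity then kills ᾱy - βȳ for every y; y
      -- = 1 and y = i give α = β = 0, and x = 1 is a contradiction.
      have hy : ∀ y, starRingEnd ℂ a * b * y - c * starRingEnd ℂ d * starRingEnd ℂ y = 0 := by
        intro y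
        apply h
        simp only [map_sub, map_mul, Complex.conj_conj]
        linear_combination y * h0
      have h1 := hy 1
      have h2 := hy Complex.I
      simp only [map_one, Complex.conj_I, mul_one] at h1 h2
      have h3 : c * starRingEnd ℂ d = 0 := by
        have : Complex.I * (c * starRingEnd ℂ d) * 2 = 0 := by
          linear_combination h2 - Complex.I * h1
        simpa using this
      have h4 : starRingEnd ℂ a * b = 0 := by linear_combination h1 + h3
      have h5 : a * starRingEnd ℂ b = 0 := by
        simpa using congrArg (starRingEnd ℂ) h4
      exact one_ne_zero (h 1 (by simp [h3, h5]))

/-- Applying `k.hom` to the second equation makes the system linear in x and `k.hom y`, so a 2×2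
determinant decides. -/
lemma pair_system_iff (k : StarKind) (a b c d a' b' c' d' : ℂ) :
    a * b * k.hom (a' * b') ≠ c * d * k.hom (c' * d') ↔
      ∀ x y, a * x * k.hom b' + c * k.hom y * k.hom d' = 0 →
        a' * y * k.hom b + c' * k.hom x * k.hom d = 0 → x = 0 ∧ y = 0 := by
  have h1 : a * b * k.hom (a' * b') ≠ c * d * k.hom (c' * d') ↔
      (!![a * k.hom b', c * k.hom d'; k.hom c' * d, k.hom a' * b]).det ≠ 0 := by
    rw [Matrix.det_fin_two_of, ne_eq, ne_eq, not_iff_not, sub_eq_zero, map_mul, map_mul]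
    constructor <;> intro h <;> linear_combination h
  rw [h1, ne_eq, ← Matrix.exists_mulVec_eq_zero_iff]
  push Not
  have h2 : ∀ x y, a' * y * k.hom b + c' * k.hom x * k.hom d = 0 ↔
      k.hom c' * d * x + k.hom a' * b * k.hom y = 0 := by
    intro x y
    rw [← map_eq_zero k.hom]
    simp only [map_add, map_mul, StarKind.hom_hom]
    constructor <;> intro h <;> linear_combination h
  constructor
  · intro h x y hx hy
    by_contra hxy
    refine h ![x, k.hom y] ?_ ?_
    · intro h0
      have h3 := congrFun h0 0
      have h4 := congrFun h0 1
      simp at h3 h4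
      exact hxy ⟨h3, h4⟩
    · funext i
      fin_cases i
      · simp
        linear_combination hx
      · simp
        linear_combination (h2 x y).1 hy
  · intro h v hv h0
    obtain ⟨h3, h4⟩ := h (v 0) (k.hom (v 1))
      (by have := congrFun h0 0
          simp [Matrix.mulVec, dotProduct, Fin.sum_univ_two] at this
          simp only [StarKind.hom_hom]
          linear_combination this)
      (by rw [h2]
          have := congrFun h0 1
          simp [Matrix.mulVec, dotProduct, Fin.sum_univ_two] at this
          simp only [StarKind.hom_hom]
          linear_combination this)
    apply hv
    funext i
    fin_cases i
    · exact h3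
    · simpa using h4

/-! ### Operators with triangular coefficients, filtered by antidiagonals. -/

section Triangular

variable {n : ℕ} {k : StarKind} {A B C D : Matrix (Fin n) (Fin n) ℂ}

/-- Matrices that vanish in all positions `(i, j)` with `s ≤ i + j`. -/
def antidiagSubmodule (n s : ℕ) : Submodule ℝ (Matrix (Fin n) (Fin n) ℂ) where
  carrier := {X | ∀ i j : Fin n, s ≤ (i : ℕ) + j → X i j = 0}
  add_mem' hX hY i j h := by simp [hX i j h, hY i j h]
  zero_mem' i j _ := rfl
  smul_mem' r X hX i j h := by simp [hX i j h]

lemma mem_antidiagSubmodule {s : ℕ} {X : Matrix (Fin n) (Fin n) ℂ} :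
    X ∈ antidiagSubmodule n s ↔ ∀ i j : Fin n, s ≤ (i : ℕ) + j → X i j = 0 := Iff.rfl

/-- Entry (i, j) only involves X_ab with a ≥ i and b ≥ j. Among these, (i, j) is the only position
on or before its antidiagonal, and `X` vanishes beyond it. -/
lemma triangular_mul_mul_apply (hA : ∀ i j, j < i → A i j = 0) (hB : ∀ i j, j < i → B i j = 0)
    {X : Matrix (Fin n) (Fin n) ℂ} {i j : Fin n}
    (hX : X ∈ antidiagSubmodule n ((i : ℕ) + j + 1)) :
    (A * X * st k B) i j = A i i * X i j * k.hom (B j j) := by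
  rw [Matrix.mul_apply, Finset.sum_eq_single j, Matrix.mul_apply, Finset.sum_eq_single i]
  · rfl
  · intro a _ ha
    rcases lt_or_gt_of_ne ha with h | h
    · simp [hA _ _ h]
    · rw [hX a j (by have : (i : ℕ) < a := h; omega), mul_zero]
  · simp
  · intro b _ hb
    rcases lt_or_gt_of_ne hb with h | h
    · simp [hB _ _ h]
    · rw [Matrix.mul_apply, Finset.sum_eq_zero, zero_mul]
      intro a _
      rcases lt_or_ge a i with h' | h'
      · simp [hA _ _ h']
      · rw [hX a b (by have : (j : ℕ) < b := h; have : (i : ℕ) ≤ a := h'; omega), mul_zero]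
  · simp

lemma st_mem_antidiagSubmodule {s : ℕ} {X : Matrix (Fin n) (Fin n) ℂ}
    (hX : X ∈ antidiagSubmodule n s) : st k X ∈ antidiagSubmodule n s := by
  intro i j h
  simp [hX j i (by omega)]

lemma triangular_op_apply (hA : ∀ i j, j < i → A i j = 0) (hB : ∀ i j, j < i → B i j = 0)
    (hC : ∀ i j, j < i → C i j = 0) (hD : ∀ i j, j < i → D i j = 0)
    {X : Matrix (Fin n) (Fin n) ℂ} {i j : Fin n} (hX : X ∈ antidiagSubmodule n ((i : ℕ) + j + 1)) :
    op k A B C D X i j =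
      A i i * X i j * k.hom (B j j) + C i i * k.hom (X j i) * k.hom (D j j) := by
  rw [op, Matrix.add_apply, triangular_mul_mul_apply hA hB hX,
    triangular_mul_mul_apply hC hD (st_mem_antidiagSubmodule hX), st_apply]

lemma antidiagSubmodule_mono {s t : ℕ} (h : s ≤ t) :
    antidiagSubmodule n s ≤ antidiagSubmodule n t := fun _ hX i j hij => hX i j (h.trans hij)

lemma triangular_op_mem (hA : ∀ i j, j < i → A i j = 0) (hB : ∀ i j, j < i → B i j = 0)
    (hC : ∀ i j, j < i → C i j = 0) (hD : ∀ i j, j < i → D i j = 0) {s : ℕ}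
    {X : Matrix (Fin n) (Fin n) ℂ} (hX : X ∈ antidiagSubmodule n s) :
    op k A B C D X ∈ antidiagSubmodule n s := by
  intro i j h
  rw [triangular_op_apply hA hB hC hD (antidiagSubmodule_mono (by omega) hX), hX i j h,
    hX j i (by omega)]
  simp

/-- If the operator is injective, its action on each antidiagonal is injective as well. -/
lemma mem_antidiagSubmodule_of_injective (hA : ∀ i j, j < i → A i j = 0)
    (hB : ∀ i j, j < i → B i j = 0)
    (hC : ∀ i j, j < i → C i j = 0) (hD : ∀ i j, j < i → D i j = 0)
    (h : Function.Injective (op k A B C D)) {s : ℕ} {Y : Matrix (Fin n) (Fin n) ℂ}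
    (hY : Y ∈ antidiagSubmodule n (s + 1))
    (h0 : ∀ i j : Fin n, (i : ℕ) + j = s →
      A i i * Y i j * k.hom (B j j) + C i i * k.hom (Y j i) * k.hom (D j j) = 0) :
    Y ∈ antidiagSubmodule n s := by
  -- The operator preserves this finite-dimensional layer, so being injective it maps the layer onto
  -- itself. The image of `Y` lies in the layer, hence so does its unique preimage `Y`.
  let f := (opLin k A B C D).restrict (p := antidiagSubmodule n s) (q := antidiagSubmodule n s)
    (fun X hX => triangular_op_mem hA hB hC hD hX)
  have hf : Function.Injective f := fun X Y hXY => Subtype.ext (h (congrArg Subtype.val hXY))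
  have hTY : op k A B C D Y ∈ antidiagSubmodule n s := by
    intro i j hij
    rcases hij.eq_or_lt with hs | hs
    · rw [triangular_op_apply hA hB hC hD (by rwa [← hs]), h0 i j hs.symm]
    · exact triangular_op_mem hA hB hC hD hY i j hs
  obtain ⟨Z, hZ⟩ := LinearMap.injective_iff_surjective.1 hf ⟨_, hTY⟩
  have : (Z : Matrix (Fin n) (Fin n) ℂ) = Y := h (congrArg Subtype.val hZ)
  exact this ▸ Z.2

/-- On the quotient by the previous layer, the operator splits into the systems for (i, j), (j, i)
and the equations at (i, i). For necessity, a solution of one such block, extended by zero, must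
fall into the previous layer and hence vanish. -/
theorem triangular_op_bijective_iff (hA : ∀ i j, j < i → A i j = 0)
    (hB : ∀ i j, j < i → B i j = 0)
    (hC : ∀ i j, j < i → C i j = 0) (hD : ∀ i j, j < i → D i j = 0) :
    Function.Bijective (op k A B C D) ↔
      PairCond k (fun i => A i i * B i i) (fun i => C i i * D i i) := by
  constructor
  · intro h
    refine ⟨fun i j hij => ?_, fun i => ?_⟩
    · rw [pair_system_iff]
      intro x y hx hy
      have := mem_antidiagSubmodule_of_injective hA hB hC hD h.1 (s := i + j)
        (Y := Matrix.of fun a b => if a = i ∧ b = j then x else if a = j ∧ b = i then y else 0)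
        (by
          intro a b hab
          simp only [Matrix.of_apply]
          rw [if_neg (by rintro ⟨rfl, rfl⟩; omega), if_neg (by rintro ⟨rfl, rfl⟩; omega)])
        (by
          intro a b _
          simp only [Matrix.of_apply]
          by_cases h1 : a = i ∧ b = j
          · obtain ⟨rfl, rfl⟩ := h1
            simpa [hij, hij.symm] using hx
          · by_cases h2 : a = j ∧ b = i
            · obtain ⟨rfl, rfl⟩ := h2
              simpa [hij, hij.symm] using hy
            · rw [if_neg h1, if_neg h2, if_neg (fun h => h2 h.symm), if_neg (fun h => h1 h.symm)]
              simp)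
      constructor
      · simpa using this i j le_rfl
      · simpa [hij, hij.symm] using this j i (by omega)
    · rw [scalarCond_iff]
      intro x hx
      have := mem_antidiagSubmodule_of_injective hA hB hC hD h.1 (s := i + i)
        (Y := Matrix.of fun a b => if a = i ∧ b = i then x else 0)
        (by
          intro a b hab
          simp only [Matrix.of_apply]
          rw [if_neg (by rintro ⟨rfl, rfl⟩; omega)])
        (by
          intro a b _
          simp only [Matrix.of_apply]
          by_cases h1 : a = i ∧ b = i
          · obtain ⟨rfl, rfl⟩ := h1
            simpa using hx
          · rw [if_neg h1, if_neg (fun h => h1 h.symm)]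
            simp)
      simpa using this i i le_rfl
  · intro h
    have hi : Function.Injective (opLin k A B C D) := by
      rw [← LinearMap.ker_eq_bot, Submodule.eq_bot_iff]
      intro X hX
      have hX : op k A B C D X = 0 := hX
      -- Descending induction on antidiagonals: no position has i + j ≥ 2n, and after 2n steps every
      -- entry is zero.
      have key : ∀ t : ℕ, X ∈ antidiagSubmodule n (2 * n - t) := by
        intro t
        induction t with
        | zero => intro i j hij; omega
        | succ t ih =>
          intro i j hij
          by_cases hs : 2 * n - t ≤ (i : ℕ) + j
          · exact ih i j hs
          have h1 := triangular_op_apply (k := k) hA hB hC hD (i := i) (j := j)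
            (antidiagSubmodule_mono (by omega) ih)
          have h2 := triangular_op_apply (k := k) hA hB hC hD (i := j) (j := i)
            (antidiagSubmodule_mono (by omega) ih)
          rw [hX, Matrix.zero_apply] at h1 h2
          by_cases hij' : i = j
          · subst hij'
            exact (scalarCond_iff k _ _ _ _).1 (h.2 i) _ h1.symm
          · exact ((pair_system_iff k _ _ _ _ _ _ _ _).1 (h.1 i j hij') _ _ h1.symm h2.symm).1
      ext i j
      exact key (2 * n) i j (by omega)
    exact ⟨hi, LinearMap.injective_iff_surjective.1 hi⟩

end Triangular

/-! ### Determinants up to a nonzero constant. -/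

section IsDet

open Polynomial

variable {ρ γ ρ' γ' : Type*} [Fintype ρ] [DecidableEq ρ] [Fintype ρ'] [DecidableEq ρ']

/-- `g` is the determinant of `M` up to a nonzero constant factor, for some identification of the
row and column indices. -/
def IsDet (M : Matrix ρ γ ℂ[X]) (g : ℂ[X]) : Prop :=
  ∃ (e : ρ ≃ γ) (ε : ℂ), ε ≠ 0 ∧ (M.submatrix id e).det = C ε * g

/-- Two identifications differ by a column permutation, so only the sign changes. -/
lemma IsDet.eq_of_equiv {M : Matrix ρ γ ℂ[X]} {g : ℂ[X]} (h : IsDet M g) (e : ρ ≃ γ) :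
    ∃ ε : ℂ, ε ≠ 0 ∧ (M.submatrix id e).det = C ε * g := by
  obtain ⟨f, ε, hε, h⟩ := h
  have h1 := Matrix.det_permute' (e.trans f.symm) (M.submatrix id f)
  rw [Matrix.submatrix_submatrix, h] at h1
  have h2 : f ∘ (e.trans f.symm) = e := by ext; simp
  rw [h2, Function.comp_id] at h1
  rcases Int.units_eq_one_or (Equiv.Perm.sign (e.trans f.symm)) with hs | hs
  · exact ⟨ε, hε, by simp [h1, hs]⟩
  · exact ⟨-ε, neg_ne_zero.2 hε, by simp [h1, hs]⟩

lemma IsDet.of_submatrix {M : Matrix ρ γ ℂ[X]} {g : ℂ[X]} (e : ρ' ≃ ρ) (f : γ' ≃ γ)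
    (h : IsDet (M.submatrix e f) g) : IsDet M g := by
  obtain ⟨e', ε, hε, h⟩ := h
  refine ⟨(e.symm.trans e').trans f, ε, hε, ?_⟩
  rw [← h, ← Matrix.det_submatrix_equiv_self e]
  congr 1
  ext i j
  simp

lemma Inverses.card_eq [Fintype γ] [DecidableEq γ] {P : Matrix ρ γ ℂ} {P' : Matrix γ ρ ℂ}
    (h : Inverses P P') :
    Fintype.card ρ = Fintype.card γ := by
  have := (Matrix.toLin'OfInv h.1 h.2).finrank_eq
  simpa using this

lemma IsDet.of_mul_mul [Fintype γ] [DecidableEq γ] [Fintype γ'] [DecidableEq γ']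
    {M : Matrix ρ γ ℂ[X]} {g : ℂ[X]} {P : Matrix ρ' ρ ℂ} {P' : Matrix ρ ρ' ℂ}
    (hP : Inverses P P') {U : Matrix γ γ' ℂ} {U' : Matrix γ' γ ℂ} (hU : Inverses U U')
    (h : IsDet (P.map C * M * U.map C) g) : IsDet M g := by
  let f : ρ ≃ ρ' := Fintype.equivOfCardEq hP.card_eq.symm
  let u : γ ≃ γ' := Fintype.equivOfCardEq hU.card_eq
  obtain ⟨e', ε, hε, h⟩ := h
  let e : ρ ≃ γ := (f.trans e').trans u.symm
  have hdet : ∀ {Q : Matrix ρ ρ ℂ} {Q' : Matrix ρ ρ ℂ}, Inverses Q Q' → Q.det ≠ 0 := by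
    intro Q Q' hQ h0
    have := congrArg Matrix.det hQ.1
    rw [Matrix.det_mul, h0] at this
    simp at this
  have h1 := hdet (hP.submatrix f (Equiv.refl ρ))
  have h2 := hdet (hU.submatrix e (f.trans e'))
  refine ⟨e, ε / ((P.submatrix f (Equiv.refl ρ)).det * (U.submatrix e (f.trans e')).det),
    div_ne_zero hε (mul_ne_zero h1 h2), ?_⟩
  have h3 : ((P.map C * M * U.map C).submatrix id e').submatrix f f =
      (P.submatrix f (Equiv.refl ρ)).map C * M.submatrix id e *
        (U.submatrix e (f.trans e')).map C := by
    refine Matrix.ext fun i j => ?_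
    simp only [Matrix.submatrix_apply, Matrix.mul_apply, Matrix.map_apply, id]
    exact (Equiv.sum_comp e fun t => (∑ s, C (P (f i) s) * M s t) * C (U t (e' (f j)))).symm
  have h4 := congrArg Matrix.det h3
  have h5 : ∀ Q : Matrix ρ ρ ℂ, (Q.map C).det = C Q.det := fun Q => (RingHom.map_det C Q).symm
  rw [Matrix.det_submatrix_equiv_self, h, Matrix.det_mul, Matrix.det_mul, h5, h5] at h4
  have h6 : C (ε / ((P.submatrix f (Equiv.refl ρ)).det * (U.submatrix e (f.trans e')).det)) *
      (C (P.submatrix f (Equiv.refl ρ)).det * C (U.submatrix e (f.trans e')).det) = C ε := by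
    rw [← C_mul, ← C_mul, div_mul_cancel₀ _ (mul_ne_zero h1 h2)]
  have h7 : C ((P.submatrix f (Equiv.refl ρ)).det * (U.submatrix e (f.trans e')).det) ≠ 0 :=
    C_ne_zero.2 (mul_ne_zero h1 h2)
  refine mul_left_cancel₀ h7 ?_
  rw [C_mul]
  linear_combination (-1 : ℂ[X]) * h4 - g * h6

lemma IsDet.fromBlocks_smul_one {δ : Type*} [Fintype δ] [DecidableEq δ] {M : Matrix ρ γ ℂ[X]}
    {g : ℂ[X]} (h : IsDet M g) (N : Matrix δ γ ℂ[X]) (y : ℂ[X]) :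
    IsDet (Matrix.fromBlocks M 0 N (y • (1 : Matrix δ δ ℂ[X]))) (y ^ Fintype.card δ * g) := by
  obtain ⟨e, ε, hε, h⟩ := h
  refine ⟨e.sumCongr (Equiv.refl δ), ε, hε, ?_⟩
  have : (Matrix.fromBlocks M 0 N (y • (1 : Matrix δ δ ℂ[X]))).submatrix id
      (e.sumCongr (Equiv.refl δ)) =
      Matrix.fromBlocks (M.submatrix id e) 0 (N.submatrix id e) (y • 1) := by
    ext (i | i) (j | j) : 2 <;> simp
  rw [this, Matrix.det_fromBlocks_zero₁₂, h, Matrix.det_smul, Matrix.det_one]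
  ring

end IsDet

/-! ### The homogeneous block pencil; (x, y) = (X, 1) and (1, X) give the pencil and its reversal.
-/

section Blocks

open Polynomial

variable {ι κ μ ν ι' κ' μ' ν' : Type*}

/-- The homogeneous matrix `[x D, y B; y A, x C]`. -/
def blockPencil (x y : ℂ[X]) (A : Matrix ι μ ℂ) (B : Matrix κ ν ℂ) (C : Matrix ι ν ℂ)
    (D : Matrix κ μ ℂ) : Matrix (κ ⊕ ι) (μ ⊕ ν) ℂ[X] :=
  Matrix.fromBlocks (x • D.map Polynomial.C) (y • B.map Polynomial.C) (y • A.map Polynomial.C)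
    (x • C.map Polynomial.C)

lemma blockPencil_swap (x y : ℂ[X]) (A : Matrix ι μ ℂ) (B : Matrix κ ν ℂ) (C : Matrix ι ν ℂ)
    (D : Matrix κ μ ℂ) : (blockPencil x y A B C D).submatrix (Equiv.refl _) (Equiv.sumComm ν μ) =
      blockPencil y x C D A B := by
  ext (i | i) (j | j) : 2 <;> simp [blockPencil]

lemma blockPencil_star (x y : ℂ[X]) (A : Matrix ι μ ℂ) (B : Matrix κ ν ℂ) (C : Matrix ι ν ℂ)
    (D : Matrix κ μ ℂ) :
    (blockPencil x y A B C D).submatrix (Equiv.sumComm ι κ) (Equiv.sumComm ν μ) =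
      blockPencil x y B A D C := by
  ext (i | i) (j | j) : 2 <;> simp [blockPencil]

/-- The product of the homogeneous binomials `c x² - a y²`. -/
def pairProd [Fintype ι] (x y : ℂ[X]) (a c : ι → ℂ) : ℂ[X] :=
  ∏ i, (C (c i) * x ^ 2 - C (a i) * y ^ 2)

variable [Fintype μ] [Fintype ν] [Fintype ι] [Fintype κ] [Fintype μ'] [Fintype ν'] [Fintype ι']
  [Fintype κ'] [DecidableEq μ] [DecidableEq ν] [DecidableEq ι] [DecidableEq κ] [DecidableEq μ']
  [DecidableEq ν'] [DecidableEq ι'] [DecidableEq κ']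

lemma isDet_blockPencil_of_equiv {x y g : ℂ[X]} (A : Matrix ι μ ℂ) (B : Matrix κ ν ℂ)
    (C : Matrix ι ν ℂ) (D : Matrix κ μ ℂ) {P : Matrix ι' ι ℂ} {P' : Matrix ι ι' ℂ}
    (hP : Inverses P P') {R : Matrix κ' κ ℂ} {R' : Matrix κ κ' ℂ} (hR : Inverses R R')
    {U : Matrix μ μ' ℂ} {U' : Matrix μ' μ ℂ} (hU : Inverses U U')
    {V : Matrix ν ν' ℂ} {V' : Matrix ν' ν ℂ} (hV : Inverses V V')
    (h : IsDet (blockPencil x y (P * A * U) (R * B * V) (P * C * V) (R * D * U)) g) :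
    IsDet (blockPencil x y A B C D) g := by
  refine IsDet.of_mul_mul (hR.fromBlocks hP) (hU.fromBlocks hV) ?_
  convert h using 1
  simp [blockPencil, Matrix.fromBlocks_map, Matrix.fromBlocks_multiply, Matrix.map_mul]

/-- Grouping the i-th indices of both halves makes the matrix block triangular, with diagonal blocks
[x D_ii, y B_ii; y A_ii, x C_ii]. -/
lemma isDet_blockPencil_triangular {n : ℕ} {A B C D : Matrix (Fin n) (Fin n) ℂ}
    (hA : ∀ i j, j < i → A i j = 0) (hB : ∀ i j, j < i → B i j = 0)
    (hC : ∀ i j, j < i → C i j = 0) (hD : ∀ i j, j < i → D i j = 0) (x y : ℂ[X]) :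
    IsDet (blockPencil x y A B C D)
      (pairProd x y (fun i => A i i * B i i) (fun i => C i i * D i i)) := by
  refine ⟨Equiv.refl _, 1, one_ne_zero, ?_⟩
  have hM : (blockPencil x y A B C D).BlockTriangular (Sum.elim id id) := by
    rintro (i | i) (j | j) hij <;>
      simp only [Sum.elim_inl, Sum.elim_inr, id] at hij <;>
      simp [blockPencil, hA i j hij, hB i j hij, hC i j hij, hD i j hij]
  rw [Equiv.coe_refl, Matrix.submatrix_id_id, hM.det_fintype, map_one, one_mul, pairProd]
  refine Finset.prod_congr rfl fun i _ => ?_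
  let f : Fin 2 → {s : Fin n ⊕ Fin n // Sum.elim id id s = i} :=
    ![⟨Sum.inl i, rfl⟩, ⟨Sum.inr i, rfl⟩]
  have hf : Function.Bijective f := by
    constructor
    · intro s t
      fin_cases s <;> fin_cases t <;> simp [f, Subtype.ext_iff]
    · rintro ⟨s | s, hs⟩
      · exact ⟨0, Subtype.ext (by simpa [f] using hs.symm)⟩
      · exact ⟨1, Subtype.ext (by simpa [f] using hs.symm)⟩
  rw [← Matrix.det_submatrix_equiv_self (Equiv.ofBijective f hf), Matrix.det_fin_two]
  simp [Matrix.toSquareBlock, Matrix.toSquareBlockProp, f, blockPencil]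
  ring

end Blocks

/-! ### Reduction of the rectangular case to the square one. -/

section RectangularReduction

open Polynomial

section Bordered

variable {ν δ : Type*} [Fintype ν] [Fintype δ] [DecidableEq δ]

/-- Splitting the unknown into its upper and lower blocks X₁, X₂, the zero blocks of the
coefficients keep X₂ out of the upper equation, while the lower one contains it only as X₂ B^⋆. So
X₁ solves the square problem and X₂ is then determined uniquely. -/
lemma op_bordered_bijective (k : StarKind) (A₁ : Matrix ν ν ℂ) (A₂ : Matrix δ ν ℂ)
    (B C₁ D₁ : Matrix ν ν ℂ) (C₂ : Matrix δ ν ℂ)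
    (hB : Function.Bijective fun X : Matrix δ ν ℂ => X * st k B) :
    Function.Bijective (op k (Matrix.fromBlocks A₁ 0 A₂ 1) B (Matrix.fromRows C₁ C₂)
      (Matrix.fromCols D₁ (0 : Matrix ν δ ℂ))) ↔ Function.Bijective (op k A₁ B C₁ D₁) := by
  let φ : Matrix ν ν ℂ × Matrix δ ν ℂ → Matrix (ν ⊕ δ) ν ℂ := fun X => Matrix.fromRows X.1 X.2
  have hφ : Function.Bijective φ := Function.bijective_iff_has_inverse.2
    ⟨fun X => (X.toRows₁, X.toRows₂), fun X => by simp [φ], fun X => by simp [φ]⟩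
  let ψ : Matrix ν ν ℂ × Matrix δ ν ℂ → Matrix ν ν ℂ × Matrix δ ν ℂ :=
    fun X => (op k A₁ B C₁ D₁ X.1, (A₂ * X.1 * st k B + C₂ * st k X.1 * st k D₁) + X.2 * st k B)
  have hst1 : ∀ (X : Matrix ν ν ℂ) (Y : Matrix δ ν ℂ),
      st k (Matrix.fromRows X Y) = Matrix.fromCols (st k X) (st k Y) := by
    intro X Y; ext i (j | j) <;> simp
  have hst2 : st k (Matrix.fromCols D₁ (0 : Matrix ν δ ℂ)) = Matrix.fromRows (st k D₁) 0 := by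
    ext (i | i) j <;> simp
  have h : op k (Matrix.fromBlocks A₁ 0 A₂ 1) B (Matrix.fromRows C₁ C₂)
      (Matrix.fromCols D₁ (0 : Matrix ν δ ℂ)) ∘ φ = φ ∘ ψ := by
    funext ⟨X, Y⟩
    simp only [Function.comp, φ, ψ, op, hst1, hst2, Matrix.fromBlocks_mul_fromRows,
      Matrix.fromRows_mul, Matrix.mul_fromCols, Matrix.fromCols_mul_fromRows]
    ext (i | i) j
    · simp
    · simp [Matrix.add_mul]
      ring
  rw [← Function.Bijective.of_comp_iff _ hφ, h, Function.Bijective.of_comp_iff' hφ]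
  constructor
  · rintro ⟨hi, hs⟩
    refine ⟨fun X Y hXY => ?_, fun E => ?_⟩
    · obtain ⟨Z, hZ⟩ := hB.2 ((A₂ * X * st k B + C₂ * st k X * st k D₁) -
        (A₂ * Y * st k B + C₂ * st k Y * st k D₁))
      have : ψ (X, 0) = ψ (Y, Z) := by
        simp only at hZ
        simp [ψ, hXY, hZ]
      exact congrArg Prod.fst (hi this)
    · obtain ⟨X, hX⟩ := hs (E, 0)
      exact ⟨X.1, congrArg Prod.fst hX⟩
  · rintro ⟨hi, hs⟩
    refine ⟨fun X Y hXY => ?_, fun E => ?_⟩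
    · obtain ⟨h1, h2⟩ := Prod.ext_iff.1 hXY
      have h3 := hi h1
      simp only [ψ, h3, add_right_inj] at h2
      exact Prod.ext h3 (hB.1 h2)
    · obtain ⟨X, hX⟩ := hs E.1
      obtain ⟨Z, hZ⟩ := hB.2 (E.2 - (A₂ * X * st k B + C₂ * st k X * st k D₁))
      refine ⟨(X, Z), Prod.ext hX ?_⟩
      simp only at hZ
      simp [ψ, hZ]

/-- The columns indexed by `δ` contain nothing but y times the identity. -/
lemma isDet_bordered [DecidableEq ν] (A₁ : Matrix ν ν ℂ) (A₂ : Matrix δ ν ℂ)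
    (B C₁ D₁ : Matrix ν ν ℂ) (C₂ : Matrix δ ν ℂ) {x y g : ℂ[X]}
    (h : IsDet (blockPencil x y A₁ B C₁ D₁) g) :
    IsDet (blockPencil x y (Matrix.fromBlocks A₁ 0 A₂ 1) B (Matrix.fromRows C₁ C₂)
      (Matrix.fromCols D₁ (0 : Matrix ν δ ℂ))) (y ^ Fintype.card δ * g) := by
  have h1 := h.fromBlocks_smul_one (Matrix.fromCols (y • A₂.map C) (x • C₂.map C)) y
  let f : (ν ⊕ ν) ⊕ δ ≃ (ν ⊕ δ) ⊕ ν :=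
    { toFun := Sum.elim (Sum.elim (Sum.inl ∘ Sum.inl) Sum.inr) (Sum.inl ∘ Sum.inr)
      invFun := Sum.elim (Sum.elim (Sum.inl ∘ Sum.inl) Sum.inr) (Sum.inl ∘ Sum.inr)
      left_inv := by rintro ((_ | _) | _) <;> rfl
      right_inv := by rintro ((_ | _) | _) <;> rfl }
  refine IsDet.of_submatrix (Equiv.sumAssoc ν ν δ) f ?_
  convert h1 using 1
  refine Matrix.ext ?_
  rintro ((i | i) | i) ((j | j) | j) <;>
    simp [blockPencil, f, Matrix.one_apply, apply_ite (C : ℂ → ℂ[X])]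

end Bordered

lemma exists_pairs_square {n : ℕ} (k : StarKind) (A B C D : Matrix (Fin n) (Fin n) ℂ) :
    ∃ a c : Fin n → ℂ, (∀ x y, IsDet (blockPencil x y A B C D) (pairProd x y a c)) ∧
      (Function.Bijective (op k A B C D) ↔ PairCond k a c) := by
  obtain ⟨P, P', R, R', U, U', V, V', hP, hR, hU, hV, h1, h2, h3, h4⟩ :=
    exists_triangularization n A B C D
  refine ⟨_, _, fun x y => isDet_blockPencil_of_equiv A B C D hP hR hU hV
    (isDet_blockPencil_triangular h1 h2 h3 h4 x y), ?_⟩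
  rw [← triangular_op_bijective_iff h1 h2 h3 h4, op_equiv_bijective k A B C D hP hR hU hV]

/-- The constant vector (u, 0) is in the kernel of the pencil. -/
lemma isDet_blockPencil_zero {m n : ℕ} {A : Matrix (Fin m) (Fin m) ℂ} (B : Matrix (Fin n) (Fin n) ℂ)
    (C : Matrix (Fin m) (Fin n) ℂ) {D : Matrix (Fin n) (Fin m) ℂ} {u : Fin m → ℂ} (hu : u ≠ 0)
    (hA : A *ᵥ u = 0) (hD : D *ᵥ u = 0) (x y : ℂ[X]) : IsDet (blockPencil x y A B C D) 0 := by
  refine ⟨Equiv.sumComm _ _, 1, one_ne_zero, ?_⟩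
  rw [mul_zero, ← Matrix.exists_mulVec_eq_zero_iff]
  let w : Fin m ⊕ Fin n → ℂ[X] := Sum.elim (Polynomial.C ∘ u) 0
  refine ⟨w ∘ Equiv.sumComm _ _, ?_, ?_⟩
  · intro h0
    apply hu
    funext i
    simpa [w] using congrFun h0 (Sum.inr i)
  · have hmap : ∀ {l : ℕ} (M : Matrix (Fin l) (Fin m) ℂ), M *ᵥ u = 0 →
        M.map Polynomial.C *ᵥ (Polynomial.C ∘ u) = 0 := by
      intro l M hM
      funext i
      have := congrArg Polynomial.C (congrFun hM i)
      simpa [Matrix.mulVec, dotProduct] using this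
    have h1 : blockPencil x y A B C D *ᵥ w = 0 := by
      rw [blockPencil, Matrix.fromBlocks_mulVec]
      simp [w, Matrix.smul_mulVec, hmap A hA, hmap D hD]
    have h2 := Matrix.submatrix_mulVec_equiv (blockPencil x y A B C D) (w ∘ Equiv.sumComm _ _) id
      (Equiv.sumComm (Fin n) (Fin m))
    rw [h2]
    funext i
    have : (w ∘ Equiv.sumComm _ _) ∘ (Equiv.sumComm (Fin n) (Fin m)).symm = w := by
      ext; simp
    rw [this, h1]
    rfl

/-- In the rectangular case with `B` invertible (or in the square case), the determinant of the
pencil splits into binomials `c x² - a y²` and the operator is bijective exactly when the pairs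
`(a : c)` satisfy the solvability condition. -/
theorem exists_pairs {m n d : ℕ} (hn : 0 < n) (hm : m = n + d) (k : StarKind)
    (A : Matrix (Fin m) (Fin m) ℂ) (B : Matrix (Fin n) (Fin n) ℂ) (C : Matrix (Fin m) (Fin n) ℂ)
    (D : Matrix (Fin n) (Fin m) ℂ)
    (hB : Function.Bijective fun X : Matrix (Fin d) (Fin n) ℂ => X * st k B) :
    ∃ a c : Fin n → ℂ, (∀ x y, IsDet (blockPencil x y A B C D) (y ^ d * pairProd x y a c)) ∧
      (Function.Bijective (op k A B C D) ↔ PairCond k a c) := by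
  -- The rank of `D` is at most n, and m - n = d.
  have hker : d ≤ Module.finrank ℂ (LinearMap.ker D.mulVecLin) := by
    have h1 := D.mulVecLin.finrank_range_add_finrank_ker
    have h2 := (LinearMap.range D.mulVecLin).finrank_le
    simp at h1 h2
    omega
  obtain ⟨f, hf⟩ := exists_linearIndependent_of_le_finrank hker
  let M : Matrix (Fin m) (Fin d) ℂ := Matrix.of fun i j => (f j : Fin m → ℂ) i
  have hM : Function.Injective M.mulVec := by
    rw [Matrix.mulVec_injective_iff]
    exact hf.map' (Submodule.subtype _) (Submodule.ker_subtype _)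
  have hDM : D * M = 0 := by
    ext i j
    exact congrFun (LinearMap.mem_ker.1 (f j).2) i
  by_cases hAM : Function.Injective (A * M).mulVec
  -- The last d columns of `U` span a subspace of ker D, and those of `P'` are their images under
  -- `A`. Hence D U ends in zero columns and P A U in the last d columns of the identity.
  · obtain ⟨U, U', hU, hUM⟩ := exists_inverses_extending (ι := Fin n) (by simpa using hm) M hM
    obtain ⟨P', P, hP, hPM⟩ := exists_inverses_extending (ι := Fin n) (by simpa using hm)
      (A * M) hAM
    have hcol : ∀ {l : Type} [Fintype l] (W : Matrix l (Fin m) ℂ) (i : l) (j : Fin d),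
        (W * U) i (Sum.inr j) = (W * M) i j := by
      intro l _ W i j
      simp [Matrix.mul_apply, hUM]
    have hA : P * A * U = Matrix.fromBlocks (P * A * U).toBlocks₁₁ 0 (P * A * U).toBlocks₂₁
        (1 : Matrix (Fin d) (Fin d) ℂ) := by
      have h3 : ∀ i j, (P * A * U) i (Sum.inr j) =
          (1 : Matrix (Fin n ⊕ Fin d) (Fin n ⊕ Fin d) ℂ) i (Sum.inr j) := by
        intro i j
        rw [hcol, Matrix.mul_assoc, ← hP.2]
        simp [Matrix.mul_apply (M := P), hPM]
      conv_lhs => rw [← Matrix.fromBlocks_toBlocks (P * A * U)]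
      congr 1
      · ext i j; simpa [Matrix.toBlocks₁₂] using h3 (Sum.inl i) j
      · ext i j; simpa [Matrix.toBlocks₂₂, Matrix.one_apply] using h3 (Sum.inr i) j
    have hD : (1 : Matrix (Fin n) (Fin n) ℂ) * D * U = Matrix.fromCols (D * U).toCols₁ 0 := by
      rw [Matrix.one_mul]
      conv_lhs => rw [← Matrix.fromCols_toCols (D * U)]
      congr 1
      ext i j
      simp [Matrix.toCols₂, hcol, hDM]
    have hC : P * C * (1 : Matrix (Fin n) (Fin n) ℂ) =
        Matrix.fromRows (P * C).toRows₁ (P * C).toRows₂ := by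
      rw [Matrix.mul_one, Matrix.fromRows_toRows]
    have hB' : (1 : Matrix (Fin n) (Fin n) ℂ) * B * (1 : Matrix (Fin n) (Fin n) ℂ) = B := by simp
    obtain ⟨a, c, h1, h2⟩ := exists_pairs_square k (P * A * U).toBlocks₁₁ B (P * C).toRows₁
      (D * U).toCols₁
    refine ⟨a, c, fun x y => ?_, ?_⟩
    · refine isDet_blockPencil_of_equiv A B C D hP.symm Inverses.one hU Inverses.one ?_
      rw [hA, hD, hC, hB']
      simpa using isDet_bordered _ (P * A * U).toBlocks₂₁ _ _ _ (P * C).toRows₂ (h1 x y)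
    · rw [← h2, ← op_equiv_bijective k A B C D hP.symm Inverses.one hU Inverses.one, hA, hD, hC, hB',
        op_bordered_bijective _ _ _ _ _ _ _ hB,
        Matrix.toBlocks_fromBlocks₁₁]
  · rw [show (A * M).mulVec = (A * M).mulVecLin from rfl, ← LinearMap.ker_eq_bot,
      Submodule.eq_bot_iff] at hAM
    push Not at hAM
    obtain ⟨v, hv, hv0⟩ := hAM
    have hu : M *ᵥ v ≠ 0 := fun h0 => hv0 (hM (by simpa using h0))
    have hAu : A *ᵥ (M *ᵥ v) = 0 := by simpa using hv
    have hDu : D *ᵥ (M *ᵥ v) = 0 := by simp [hDM]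
    -- Now `A` and `D` share a kernel vector, so the operator is not injective and the determinant
    -- vanishes. The pairs (0, 0) record both failures, since n > 0.
    refine ⟨0, 0, fun x y => ?_, iff_of_false (fun h => ?_) (fun h => ?_)⟩
    · have : pairProd x y (0 : Fin n → ℂ) 0 = 0 := by
        simp [pairProd, hn.ne']
      rw [this, mul_zero]
      exact isDet_blockPencil_zero B C hu hAu hDu x y
    · have hw : (1 : Fin n → ℂ) ≠ 0 := fun h0 => by simpa using congrFun h0 ⟨0, hn⟩
      exact not_injective_of_kernel_AD hu hw hAu hDu h.1
    · simpa using (h.2 ⟨0, hn⟩).ne_zero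

end RectangularReduction

/-! ### Degree and root multiplicities of products of binomials. -/

section PairPolynomial

open Polynomial

variable {ι : Type*} [Fintype ι] {a c : ι → ℂ}

/-- The binomial `c X² - a`. -/
def pairPoly (a c : ℂ) : ℂ[X] := C c * X ^ 2 - C a

lemma pairPoly_ne_zero {a c : ℂ} (h : a ≠ 0 ∨ c ≠ 0) : pairPoly a c ≠ 0 := by
  intro h0
  have h1 := congrArg (fun f => f.coeff 0) h0
  have h2 := congrArg (fun f => f.coeff 2) h0
  simp [pairPoly, coeff_C] at h1 h2
  tauto

lemma natDegree_pairPoly (a c : ℂ) : (pairPoly a c).natDegree = if c = 0 then 0 else 2 := by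
  split_ifs with h
  · simp [pairPoly, h]
  · rw [pairPoly]
    compute_degree!

lemma rootMultiplicity_pairPoly {a c w : ℂ} (h : a ≠ 0 ∨ c ≠ 0) (hw : w ^ 2 = 1) :
    (pairPoly a c).rootMultiplicity w = if a = c then 1 else 0 := by
  have hw0 : w ≠ 0 := by rintro rfl; simp at hw
  split_ifs with hac
  · subst hac
    have ha : a ≠ 0 := by tauto
    have h1 : 0 < (pairPoly a a).rootMultiplicity w := by
      rw [rootMultiplicity_pos (pairPoly_ne_zero h)]
      simp [pairPoly, hw]
    have h2 : ¬ 1 < (pairPoly a a).rootMultiplicity w := by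
      rw [one_lt_rootMultiplicity_iff_isRoot (pairPoly_ne_zero h)]
      simp [pairPoly, hw0, ha]
    omega
  · rw [rootMultiplicity_eq_zero_iff]
    intro h1
    simp [pairPoly, hw, sub_eq_zero] at h1
    exact absurd h1.symm hac

lemma pairProd_X_one (a c : ι → ℂ) : pairProd X 1 a c = ∏ i, pairPoly (a i) (c i) := by
  simp [pairProd, pairPoly]

lemma pairProd_one_X (a c : ι → ℂ) :
    pairProd 1 X a c = C ((-1) ^ Fintype.card ι) * ∏ i, pairPoly (c i) (a i) := by
  rw [pairProd, C_pow, ← Finset.card_univ, ← Finset.prod_const, ← Finset.prod_mul_distrib]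
  refine Finset.prod_congr rfl fun i _ => ?_
  simp [pairPoly]

lemma prod_pairPoly_ne_zero_iff :
    ∏ i, pairPoly (a i) (c i) ≠ 0 ↔ ∀ i, a i ≠ 0 ∨ c i ≠ 0 := by
  rw [Finset.prod_ne_zero_iff]
  refine ⟨fun h i => ?_, fun h i _ => pairPoly_ne_zero (h i)⟩
  by_contra! h0
  exact h i (Finset.mem_univ i) (by simp [pairPoly, h0])

lemma isRoot_prod_pairPoly (w : ℂ) :
    (∏ i, pairPoly (a i) (c i)).IsRoot w ↔ ∃ i, c i * w ^ 2 = a i := by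
  simp [IsRoot, eval_prod, Finset.prod_eq_zero_iff, pairPoly, sub_eq_zero]

lemma natDegree_prod_pairPoly_lt_iff (h : ∀ i, a i ≠ 0 ∨ c i ≠ 0) (d : ℕ) :
    (X ^ d * ∏ i, pairPoly (a i) (c i)).natDegree < 2 * Fintype.card ι + d ↔ ∃ i, c i = 0 := by
  have h0 := prod_pairPoly_ne_zero_iff.2 h
  rw [natDegree_mul (pow_ne_zero _ X_ne_zero) h0, natDegree_X_pow,
    natDegree_prod _ _ fun i _ => pairPoly_ne_zero (h i), add_comm d, add_lt_add_iff_right]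
  simp only [natDegree_pairPoly]
  have h1 : 2 * Fintype.card ι = ∑ i : ι, 2 := by simp [mul_comm]
  rw [h1]
  constructor
  · intro h2
    by_contra! h3
    simp [h3] at h2
  · rintro ⟨i, hi⟩
    refine Finset.sum_lt_sum (fun j _ => ?_) ⟨i, Finset.mem_univ i, by simp [hi]⟩
    split_ifs <;> simp

open Classical in
lemma rootMultiplicity_prod_pairPoly (h : ∀ i, a i ≠ 0 ∨ c i ≠ 0) {w : ℂ} (hw : w ^ 2 = 1) (d : ℕ) :
    (X ^ d * ∏ i, pairPoly (a i) (c i)).rootMultiplicity w =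
      (Finset.univ.filter fun i => a i = c i).card := by
  have h0 := prod_pairPoly_ne_zero_iff.2 h
  have hw0 : w ≠ 0 := by rintro rfl; simp at hw
  rw [rootMultiplicity_mul (mul_ne_zero (pow_ne_zero _ X_ne_zero) h0),
    rootMultiplicity_eq_zero (by simp [hw0]), zero_add, ← count_roots, roots_prod _ _ h0,
    Multiset.count_bind, Finset.card_filter]
  refine congrArg Multiset.sum (Multiset.map_congr rfl fun i _ => ?_)
  rw [count_roots, rootMultiplicity_pairPoly (h i) hw]

/-- The factor X^d contributes exactly d, so any excess comes from a pair. This is the threshold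
that decides whether `coreSpectrum` keeps the point. -/
lemma lt_rootMultiplicity_zero_iff (h : ∀ i, a i ≠ 0 ∨ c i ≠ 0) (d : ℕ) :
    d < (X ^ d * ∏ i, pairPoly (a i) (c i)).rootMultiplicity 0 ↔ ∃ i, a i = 0 := by
  have h0 := prod_pairPoly_ne_zero_iff.2 h
  have h1 : (X ^ d : ℂ[X]).rootMultiplicity 0 = d := by
    simpa using rootMultiplicity_X_sub_C_pow (0 : ℂ) d
  rw [rootMultiplicity_mul (mul_ne_zero (pow_ne_zero _ X_ne_zero) h0), h1,
    lt_add_iff_pos_right, rootMultiplicity_pos h0, isRoot_prod_pairPoly]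
  simp [eq_comm]

lemma rootMultiplicity_C_mul_eq {ε : ℂ} (hε : ε ≠ 0) (g : ℂ[X]) (w : ℂ) :
    (C ε * g).rootMultiplicity w = g.rootMultiplicity w := by
  rw [← count_roots, roots_C_mul _ hε, count_roots]

end PairPolynomial

/-! ### Square roots of projective points, reciprocals and conjugates. -/

section ProjectivePoints

/-- `z² = (a : c)` in the projective line. -/
def IsSqrt (z : OnePoint ℂ) (a c : ℂ) : Prop :=
  match z with
  | none => c = 0
  | some w => c * w ^ 2 = a

lemma isSqrt_coe {w a c : ℂ} : IsSqrt (w : OnePoint ℂ) a c ↔ c * w ^ 2 = a := Iff.rfl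

lemma isSqrt_infty {a c : ℂ} : IsSqrt OnePoint.infty a c ↔ c = 0 := Iff.rfl

lemma recip_infty : recip OnePoint.infty = ((0 : ℂ) : OnePoint ℂ) := rfl

lemma recip_zero : recip ((0 : ℂ) : OnePoint ℂ) = OnePoint.infty := if_pos rfl

lemma recip_coe {w : ℂ} (hw : w ≠ 0) : recip (w : OnePoint ℂ) = ((w⁻¹ : ℂ) : OnePoint ℂ) :=
  if_neg hw

lemma recip_recip (z : OnePoint ℂ) : recip (recip z) = z := by
  induction z using OnePoint.rec with
  | infty => rw [recip_infty, recip_zero]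
  | coe w =>
    by_cases hw : w = 0
    · rw [hw, recip_zero, recip_infty]
    · rw [recip_coe hw, recip_coe (inv_ne_zero hw), inv_inv]

lemma exists_isSqrt (a c : ℂ) : ∃ z, IsSqrt z a c := by
  by_cases hc : c = 0
  · exact ⟨OnePoint.infty, hc⟩
  · obtain ⟨w, hw⟩ := IsAlgClosed.exists_pow_nat_eq (a / c) (n := 2) (by norm_num)
    exact ⟨(w : OnePoint ℂ), by rw [isSqrt_coe, hw, mul_div_cancel₀ _ hc]⟩

lemma IsSqrt.recip {z : OnePoint ℂ} {a c : ℂ} (h : IsSqrt z a c) : IsSqrt (recip z) c a := by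
  induction z using OnePoint.rec with
  | infty => rw [recip_infty, isSqrt_coe]; simpa using h.symm
  | coe w =>
    rw [isSqrt_coe] at h
    by_cases hw : w = 0
    · rw [hw, recip_zero, isSqrt_infty, ← h, hw]; simp
    · rw [recip_coe hw, isSqrt_coe, ← h]
      field_simp

lemma IsSqrt.mul_eq {z : OnePoint ℂ} {a c a' c' : ℂ} (h : IsSqrt z a c) (h' : IsSqrt z a' c') :
    a * c' = c * a' := by
  induction z using OnePoint.rec with
  | infty => rw [isSqrt_infty] at h h'; simp [h, h']
  | coe w => rw [isSqrt_coe] at h h'; rw [← h, ← h']; ring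

/-- The cross-product identity says that (a : c) and (a' : c') are the same point. Nondegeneracy of
the first pair is needed, since (0, 0) satisfies every such identity. -/
lemma IsSqrt.of_mul_eq {z : OnePoint ℂ} {a c a' c' : ℂ} (h : IsSqrt z a c)
    (hne : a ≠ 0 ∨ c ≠ 0) (he : a * c' = c * a') : IsSqrt z a' c' := by
  induction z using OnePoint.rec with
  | infty =>
    rw [isSqrt_infty] at h ⊢
    simpa [h, hne.resolve_right (not_not.2 h)] using he
  | coe w =>
    rw [isSqrt_coe] at h ⊢
    have hc : c ≠ 0 := by rintro rfl; simp at h; simp [← h] at hne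
    refine mul_left_cancel₀ hc ?_
    rw [← he, ← h]; ring

lemma conj_coe (w : ℂ) : conj (w : OnePoint ℂ) = ((starRingEnd ℂ w : ℂ) : OnePoint ℂ) := rfl

lemma conj_infty : conj OnePoint.infty = OnePoint.infty := rfl

lemma conj_conj (z : OnePoint ℂ) : conj (conj z) = z := by
  induction z using OnePoint.rec with
  | infty => rfl
  | coe w => rw [conj_coe, conj_coe, Complex.conj_conj]

lemma IsSqrt.conj {z : OnePoint ℂ} {a c : ℂ} (h : IsSqrt z a c) :
    IsSqrt (conj z) (starRingEnd ℂ a) (starRingEnd ℂ c) := by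
  induction z using OnePoint.rec with
  | infty => rw [isSqrt_infty] at h; rw [conj_infty, isSqrt_infty, h, map_zero]
  | coe w => rw [isSqrt_coe] at h; rw [conj_coe, isSqrt_coe, ← h]; simp

lemma isSqrt_self_iff {z : OnePoint ℂ} {a c : ℂ} (hne : a ≠ 0 ∨ c ≠ 0) (h : IsSqrt z a c) :
    (z = ((1 : ℂ) : OnePoint ℂ) ∨ z = ((-1 : ℂ) : OnePoint ℂ)) ↔ a = c := by
  constructor
  · rintro (rfl | rfl) <;> rw [isSqrt_coe] at h <;> simpa using h.symm
  · rintro rfl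
    have ha : a ≠ 0 := by tauto
    induction z using OnePoint.rec with
    | infty => exact absurd h ha
    | coe w =>
      rw [isSqrt_coe] at h
      have : w ^ 2 = 1 := mul_left_cancel₀ ha (by rw [h, mul_one])
      simpa using this

end ProjectivePoints

/-! ### The spectral condition in terms of pairs. -/

section Conditions

variable {ι : Type*} [Fintype ι] {a c : ι → ℂ}

open Classical in
-- Taking reciprocals swaps a and c, so a_i σ(a_j) = c_i σ(c_j) says that a square root of pair i is
-- the (conjugate) reciprocal of one of pair j. For ⊤ and i = j this reads a_i = ±c_i. The sign +
-- gives the eigenvalues ±1, whose common multiplicity counts such pairs; the sign - gives ±i, which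
-- are reciprocal to each other and excluded by both sides.
theorem spectralCondition_iff {r s : ℕ} {k : StarKind} {P : Pencil r s} {S : Set (OnePoint ℂ)}
    (hne : ∀ i, a i ≠ 0 ∨ c i ≠ 0) (hS : ∀ z, z ∈ S ↔ ∃ i, IsSqrt z (a i) (c i))
    (h1 : P.mult ((1 : ℂ) : OnePoint ℂ) = (Finset.univ.filter fun i => a i = c i).card)
    (h2 : P.mult ((-1 : ℂ) : OnePoint ℂ) = (Finset.univ.filter fun i => a i = c i).card) :
    SpectralCondition k P S ↔ PairCond k a c := by
  cases k with
  | conjTranspose =>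
    simp only [SpectralCondition, StarReciprocalFree, PairCond, ScalarCond, StarKind.hom]
    have hall : ((∀ i j, i ≠ j → a i * starRingEnd ℂ (a j) ≠ c i * starRingEnd ℂ (c j)) ∧
        ∀ i, a i * starRingEnd ℂ (a i) ≠ c i * starRingEnd ℂ (c i)) ↔
        ∀ i j, a i * starRingEnd ℂ (a j) ≠ c i * starRingEnd ℂ (c j) := by
      refine ⟨fun h i j => ?_, fun h => ⟨fun i j _ => h i j, fun i => h i i⟩⟩
      by_cases hij : i = j
      · subst hij; exact h.2 i
      · exact h.1 i j hij
    rw [hall]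
    constructor
    · intro h i j hij
      obtain ⟨z, hz⟩ := exists_isSqrt (a i) (c i)
      have h3 : IsSqrt z (starRingEnd ℂ (c j)) (starRingEnd ℂ (a j)) := hz.of_mul_eq (hne i) hij
      have h4 := h3.recip.conj
      simp only [Complex.conj_conj] at h4
      refine h z ((hS z).2 ⟨i, hz⟩) _ ((hS _).2 ⟨j, h4⟩) ?_
      rw [conj_conj, recip_recip]
    · rintro h z hz w hw rfl
      obtain ⟨i, hi⟩ := (hS _).1 hz
      obtain ⟨j, hj⟩ := (hS _).1 hw
      exact h i j (hi.mul_eq hj.conj.recip)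
  | transpose =>
    simp only [SpectralCondition, ReciprocalFree, PairCond, ScalarCond, StarKind.hom,
      RingHom.id_apply, h1, h2, Set.mem_sdiff, Set.mem_insert_iff, Set.mem_singleton_iff, true_and]
    rw [Finset.card_le_one]
    simp only [Finset.mem_filter, Finset.mem_univ, true_and]
    constructor
    · rintro ⟨h, hcard⟩
      have key : ∀ i j, a i ≠ c i → a i * a j = c i * c j → False := by
        intro i j hi hij
        obtain ⟨z, hz⟩ := exists_isSqrt (a i) (c i)
        have h3 : IsSqrt z (c j) (a j) := hz.of_mul_eq (hne i) hij
        have hj : a j ≠ c j := fun h0 => hi ((isSqrt_self_iff (hne i) hz).1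
          ((isSqrt_self_iff (hne j).symm h3).2 h0.symm))
        refine h z ⟨(hS z).2 ⟨i, hz⟩, fun h0 => hi ((isSqrt_self_iff (hne i) hz).1 h0)⟩ (recip z)
          ⟨(hS _).2 ⟨j, h3.recip⟩, fun h0 => hj ((isSqrt_self_iff (hne j) h3.recip).1 h0)⟩
          (recip_recip z).symm
      refine ⟨fun i j hij he => ?_, fun i hi => ?_⟩
      · by_cases hi : a i = c i
        · by_cases hj : a j = c j
          · exact hij (hcard i hi j hj)
          · exact key j i hj (by linear_combination he)
        · exact key i j hi he
      · refine key i i (fun h0 => ?_) (by linear_combination (a i - c i) * hi)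
        have hc : c i = 0 := by
          have : (2 : ℂ) * c i = 0 := by linear_combination hi - h0
          simpa using this
        have := hne i
        simp [h0, hc] at this
    · rintro ⟨h, hdiag⟩
      refine ⟨?_, fun i hi j hj => ?_⟩
      · rintro z ⟨hz, hz1⟩ w ⟨hw, hw1⟩ rfl
        obtain ⟨i, hi⟩ := (hS _).1 hz
        obtain ⟨j, hj⟩ := (hS _).1 hw
        have he := hi.mul_eq hj.recip
        by_cases hij : i = j
        · subst hij
          have h3 : (a i + c i) * (a i - c i) = 0 := by linear_combination he
          have h4 := (mul_eq_zero.1 h3).resolve_left (hdiag i)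
          exact hz1 ((isSqrt_self_iff (hne i) hi).2 (sub_eq_zero.1 h4))
        · exact h i j hij he
      · by_contra hij
        exact h i j hij (by rw [hi, hj])

end Conditions

/-! ### From the determinant of a pencil to regularity and the spectral condition. -/

section Pencils

open Polynomial

lemma PairCond.ne_zero {ι : Type*} {k : StarKind} {a c : ι → ℂ} (h : PairCond k a c) (i : ι) :
    a i ≠ 0 ∨ c i ≠ 0 := (h.2 i).ne_zero

variable {ι : Type*} [Fintype ι] {a c : ι → ℂ} {r s d : ℕ} {P : Pencil r s} {k : StarKind}

lemma Pencil.exists_det_eq {g : ℂ[X]} (hrs : r = s) (h : IsDet P.toPolyMatrix g) :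
    ∃ ε : ℂ, ε ≠ 0 ∧ P.det = C ε * g := by
  obtain ⟨ε, hε, h⟩ := h.eq_of_equiv (finCongr hrs)
  exact ⟨ε, hε, by rw [Pencil.det, dif_pos hrs, ← h]; rfl⟩

lemma Pencil.isRegular_iff (hrs : r = s) : P.IsRegular ↔ P.det ≠ 0 := by
  simp [Pencil.IsRegular, Pencil.IsSingular, hrs]

lemma isRegular_iff_of_isDet {g : ℂ[X]} (hrs : r = s) (h : IsDet P.toPolyMatrix g) :
    P.IsRegular ↔ g ≠ 0 := by
  obtain ⟨ε, hε, h⟩ := Pencil.exists_det_eq hrs h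
  rw [Pencil.isRegular_iff hrs, h]
  simp [hε]

lemma mult_coe (w : ℂ) : P.mult (w : OnePoint ℂ) = P.det.rootMultiplicity w := rfl

lemma mult_infty : P.mult OnePoint.infty = P.rev.det.rootMultiplicity 0 := rfl

lemma coe_mem_spectrum {w : ℂ} : (w : OnePoint ℂ) ∈ P.spectrum ↔ P.det.IsRoot w := by
  simp [Pencil.spectrum]

lemma infty_mem_spectrum : OnePoint.infty ∈ P.spectrum ↔ P.det.natDegree < r := by
  simp [Pencil.spectrum]

lemma mem_coreSpectrum_self {z : OnePoint ℂ} :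
    z ∈ P.coreSpectrum z d ↔ d < P.mult z ∧ z ∈ P.spectrum := by
  unfold Pencil.coreSpectrum
  split_ifs with h <;> simp [h]

lemma mem_coreSpectrum_of_ne {z w : OnePoint ℂ} (hzw : w ≠ z) :
    w ∈ P.coreSpectrum z d ↔ w ∈ P.spectrum := by
  unfold Pencil.coreSpectrum
  split_ifs with h <;> simp [hzw]


lemma IsDet.of_C_mul {ρ γ : Type*} [Fintype ρ] [DecidableEq ρ] {M : Matrix ρ γ ℂ[X]} {g : ℂ[X]}
    {δ : ℂ} (hδ : δ ≠ 0) (h : IsDet M (C δ * g)) : IsDet M g := by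
  obtain ⟨e, ε, hε, h⟩ := h
  exact ⟨e, ε * δ, mul_ne_zero hε hδ, by rw [h, C_mul, mul_assoc]⟩

/-- Regularity means that no pair is (0, 0), which `PairCond` implies. So `S` need only be described
for nondegenerate pairs. -/
theorem regular_and_condition_iff {e : ℕ} {S : Set (OnePoint ℂ)} (hrs : r = s)
    (h : IsDet P.toPolyMatrix (X ^ e * ∏ i, pairPoly (a i) (c i)))
    (hS : (∀ i, a i ≠ 0 ∨ c i ≠ 0) → ∀ ε : ℂ, ε ≠ 0 →
      P.det = C ε * (X ^ e * ∏ i, pairPoly (a i) (c i)) →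
        ∀ z, z ∈ S ↔ ∃ i, IsSqrt z (a i) (c i)) :
    (P.IsRegular ∧ SpectralCondition k P S) ↔ PairCond k a c := by
  classical
  have hreg : P.IsRegular ↔ ∀ i, a i ≠ 0 ∨ c i ≠ 0 := by
    rw [isRegular_iff_of_isDet hrs h, ← prod_pairPoly_ne_zero_iff, mul_ne_zero_iff]
    simp
  obtain ⟨ε, hε, h⟩ := Pencil.exists_det_eq hrs h
  rw [hreg, ← and_iff_right_of_imp (fun hpc : PairCond k a c => hpc.ne_zero)]
  refine and_congr_right fun hne => ?_
  refine spectralCondition_iff hne (hS hne ε hε h) ?_ ?_ <;>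
  · rw [mult_coe, h, rootMultiplicity_C_mul_eq hε, rootMultiplicity_prod_pairPoly hne (by norm_num)]

lemma coe_mem_spectrum_iff {e : ℕ} {ε : ℂ} (hε : ε ≠ 0)
    (h : P.det = C ε * (X ^ e * ∏ i, pairPoly (a i) (c i))) {w : ℂ} (hw : w ≠ 0 ∨ e = 0) :
    (w : OnePoint ℂ) ∈ P.spectrum ↔ ∃ i, IsSqrt (w : OnePoint ℂ) (a i) (c i) := by
  have hX : ¬ (X ^ e : ℂ[X]).IsRoot w := by
    rcases hw with hw | rfl <;> simp [*]
  rw [coe_mem_spectrum, h, root_mul, root_mul, isRoot_prod_pairPoly, or_iff_right hX,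
    or_iff_right (by simpa using hε)]
  rfl

lemma infty_mem_spectrum_iff {e : ℕ} {ε : ℂ} (hε : ε ≠ 0)
    (h : P.det = C ε * (X ^ e * ∏ i, pairPoly (a i) (c i))) (hne : ∀ i, a i ≠ 0 ∨ c i ≠ 0)
    (hr : r = 2 * Fintype.card ι + e) :
    OnePoint.infty ∈ P.spectrum ↔ ∃ i, IsSqrt OnePoint.infty (a i) (c i) := by
  rw [infty_mem_spectrum, h, natDegree_C_mul hε, hr, natDegree_prod_pairPoly_lt_iff hne]
  rfl

/-- The spectral characterization for a pencil with determinant `∏ (c X² - a)`. -/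
theorem regular_and_spectrum_iff (hrs : r = s) (hr : r = 2 * Fintype.card ι)
    (h : IsDet P.toPolyMatrix (∏ i, pairPoly (a i) (c i))) :
    (P.IsRegular ∧ SpectralCondition k P P.spectrum) ↔ PairCond k a c := by
  refine regular_and_condition_iff (e := 0) hrs (by simpa using h) fun hne ε hε h z => ?_
  induction z using OnePoint.rec with
  | infty => exact infty_mem_spectrum_iff hε h hne (by simpa using hr)
  | coe w => exact coe_mem_spectrum_iff hε h (Or.inr rfl)

/-- The spectral characterization for a pencil with determinant `∏ (c X² - a)` and `d` forced
infinite eigenvalues. -/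
theorem regular_and_hat_iff (hrs : r = s) (hr : r = 2 * Fintype.card ι + d)
    (h : IsDet P.toPolyMatrix (∏ i, pairPoly (a i) (c i)))
    (h' : IsDet P.rev.toPolyMatrix (X ^ d * ∏ i, pairPoly (c i) (a i))) :
    (P.IsRegular ∧ SpectralCondition k P (P.coreSpectrum OnePoint.infty d)) ↔ PairCond k a c := by
  refine regular_and_condition_iff (e := 0) hrs (by simpa using h) fun hne ε hε h z => ?_
  induction z using OnePoint.rec with
  | infty =>
    obtain ⟨ε', hε', h'⟩ := Pencil.exists_det_eq hrs h'
    rw [mem_coreSpectrum_self, mult_infty, h', rootMultiplicity_C_mul_eq hε',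
      lt_rootMultiplicity_zero_iff fun i => (hne i).symm]
    refine and_iff_left_of_imp fun h0 => ?_
    rw [infty_mem_spectrum, h, natDegree_C_mul hε]
    have := (natDegree_prod_pairPoly_lt_iff hne 0).2 h0
    omega
  | coe w =>
    rw [mem_coreSpectrum_of_ne (OnePoint.coe_ne_infty w)]
    exact coe_mem_spectrum_iff hε h (Or.inr rfl)

/-- The spectral characterization for a pencil with determinant `X ^ d ∏ (c X² - a)`. -/
theorem regular_and_tilde_iff (hrs : r = s) (hr : r = 2 * Fintype.card ι + d)
    (h : IsDet P.toPolyMatrix (X ^ d * ∏ i, pairPoly (a i) (c i))) :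
    (P.IsRegular ∧ SpectralCondition k P (P.coreSpectrum ((0 : ℂ) : OnePoint ℂ) d)) ↔
      PairCond k a c := by
  refine regular_and_condition_iff hrs h fun hne ε hε h z => ?_
  induction z using OnePoint.rec with
  | infty =>
    rw [mem_coreSpectrum_of_ne (OnePoint.infty_ne_coe 0)]
    exact infty_mem_spectrum_iff hε h hne hr
  | coe w =>
    by_cases hw : w = 0
    · subst hw
      rw [mem_coreSpectrum_self, mult_coe, coe_mem_spectrum]
      have h0 : P.det ≠ 0 := by
        rw [h]
        simp [hε, prod_pairPoly_ne_zero_iff.2 hne]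
      rw [← rootMultiplicity_pos h0, and_iff_left_of_imp (fun h => by omega), h,
        rootMultiplicity_C_mul_eq hε, lt_rootMultiplicity_zero_iff hne]
      simp [isSqrt_coe, eq_comm]
    · rw [mem_coreSpectrum_of_ne (by simpa using hw)]
      exact coe_mem_spectrum_iff hε h (Or.inl hw)

end Pencils

/-! ### The three size patterns. -/

section Main

open Polynomial

variable {p m n q : ℕ} {k : StarKind}

lemma isDet_pencilQ {A : Matrix (Fin p) (Fin m) ℂ} {B : Matrix (Fin n) (Fin q) ℂ}
    {C : Matrix (Fin p) (Fin n) ℂ} {D : Matrix (Fin m) (Fin q) ℂ} {g : ℂ[X]}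
    (h : IsDet (blockPencil X 1 A (st k B) C (st k D)) g) :
    IsDet (pencilQ k A B C D).toPolyMatrix g := by
  refine IsDet.of_submatrix finSumFinEquiv finSumFinEquiv ?_
  convert h using 1
  refine Matrix.ext ?_
  rintro (i | i) (j | j) <;> simp [Pencil.toPolyMatrix, pencilQ, blockPencil, app_eq_st]

lemma isDet_rev_pencilQ {A : Matrix (Fin p) (Fin m) ℂ} {B : Matrix (Fin n) (Fin q) ℂ}
    {C : Matrix (Fin p) (Fin n) ℂ} {D : Matrix (Fin m) (Fin q) ℂ} {g : ℂ[X]}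
    (h : IsDet (blockPencil 1 X A (st k B) C (st k D)) g) :
    IsDet (pencilQ k A B C D).rev.toPolyMatrix g := by
  refine IsDet.of_submatrix finSumFinEquiv finSumFinEquiv ?_
  convert h using 1
  refine Matrix.ext ?_
  rintro (i | i) (j | j) <;> simp [Pencil.toPolyMatrix, Pencil.rev, pencilQ, blockPencil, app_eq_st]

lemma IsInvertible.st {B : Matrix (Fin m) (Fin n) ℂ} (h : IsInvertible B) :
    IsInvertible (st k B) := by
  obtain ⟨N, hN⟩ := h
  exact ⟨_, Inverses.st k hN⟩

lemma isInvertible_st {B : Matrix (Fin m) (Fin n) ℂ} :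
    IsInvertible (st k B) ↔ IsInvertible B :=
  ⟨fun h => by simpa using h.st (k := k), fun h => h.st⟩

lemma exists_kernel_of_not_isInvertible {B : Matrix (Fin n) (Fin n) ℂ} (h : ¬ IsInvertible B) :
    ∃ w, w ≠ 0 ∧ B *ᵥ w = 0 :=
  exists_kernel_of_not_isUnit fun hB =>
    h ⟨B⁻¹, Matrix.mul_nonsing_inv _ hB, Matrix.nonsing_inv_mul _ hB⟩

/-- The side condition on the invertible coefficient in the rectangular case. -/
def SideCond (A : Matrix (Fin m) (Fin m) ℂ) (B : Matrix (Fin n) (Fin n) ℂ) : Prop :=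
  (n < m ∧ IsInvertible B) ∨ (m < n ∧ IsInvertible A)

/-- When m ≠ n, one of `C`, `D` is wide and has a kernel vector. Paired with one of a singular `A`
or `B` respectively, it gives a rank-one kernel element. -/
lemma sideCond_of_bijective {A : Matrix (Fin m) (Fin m) ℂ} {B : Matrix (Fin n) (Fin n) ℂ}
    {C : Matrix (Fin m) (Fin n) ℂ} {D : Matrix (Fin n) (Fin m) ℂ} (hmn : m ≠ n)
    (h : Function.Bijective (op k A B C D)) : SideCond A B := by
  rcases lt_or_gt_of_ne hmn with hlt | hlt
  · refine Or.inr ⟨hlt, by_contra fun hA => ?_⟩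
    obtain ⟨u, hu, hu'⟩ := exists_kernel_of_not_isInvertible hA
    obtain ⟨w, hw, hw'⟩ := exists_mulVec_eq_zero_of_card_lt C (by simpa)
    exact not_injective_of_kernel_AC hu hw hu' hw' h.1
  · refine Or.inl ⟨hlt, by_contra fun hB => ?_⟩
    obtain ⟨w, hw, hw'⟩ := exists_kernel_of_not_isInvertible hB
    obtain ⟨u, hu, hu'⟩ := exists_mulVec_eq_zero_of_card_lt D (by simpa)
    exact not_injective_of_kernel_BD hu hw hu' hw' h.1

lemma IsInvertible.mul_st_bijective {B : Matrix (Fin n) (Fin n) ℂ} (h : IsInvertible B) (d : ℕ) :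
    Function.Bijective fun X : Matrix (Fin d) (Fin n) ℂ => X * StarSylvester.st k B := by
  obtain ⟨N, hN⟩ := h.st (k := k)
  exact Inverses.mul_right_bijective hN _

/-- Applying ⋆ to the equation exchanges A with B and C with D, which reduces m < n to m > n. The
number of pairs is min(m, n). -/
lemma exists_pairs_of_sideCond (hm : 0 < m) (hn : 0 < n) (k : StarKind)
    {A : Matrix (Fin m) (Fin m) ℂ} {B : Matrix (Fin n) (Fin n) ℂ} (C : Matrix (Fin m) (Fin n) ℂ)
    (D : Matrix (Fin n) (Fin m) ℂ) (h : SideCond A B) :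
    ∃ (l : ℕ) (a c : Fin l → ℂ), m + n = 2 * l + ((m : ℤ) - n).natAbs ∧
      (∀ x y, IsDet (blockPencil x y A B C D) (y ^ ((m : ℤ) - n).natAbs * pairProd x y a c)) ∧
      (Function.Bijective (op k A B C D) ↔ PairCond k a c) := by
  rcases h with ⟨hlt, hB⟩ | ⟨hlt, hA⟩
  · obtain ⟨a, c, h1, h2⟩ := exists_pairs (d := ((m : ℤ) - n).natAbs) hn (by omega) k A B C D
      (hB.mul_st_bijective _)
    exact ⟨n, a, c, by omega, h1, h2⟩
  · obtain ⟨a, c, h1, h2⟩ := exists_pairs (d := ((m : ℤ) - n).natAbs) hm (by omega) k B A D C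
      (hA.mul_st_bijective _)
    refine ⟨m, a, c, by omega, fun x y => ?_, by rw [← h2, op_star_bijective]⟩
    refine IsDet.of_submatrix (Equiv.sumComm _ _) (Equiv.sumComm _ _) ?_
    rw [blockPencil_star]
    exact h1 x y

lemma neg_one_pow_ne_zero_complex (l : ℕ) : ((-1 : ℂ)) ^ l ≠ 0 := pow_ne_zero _ (by norm_num)

theorem bijective_iff_of_eq_of_sideCond (hm : 0 < m) (hn : 0 < n) {A : Matrix (Fin m) (Fin m) ℂ}
    {B : Matrix (Fin n) (Fin n) ℂ} (C : Matrix (Fin m) (Fin n) ℂ) (D : Matrix (Fin m) (Fin n) ℂ)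
    (h : SideCond A (st k B)) : Function.Bijective (op k A (st k B) C (st k D)) ↔
      (pencilQ k A B C D).IsRegular ∧
        SpectralCondition k (pencilQ k A B C D) (hatSpectrum (pencilQ k A B C D) m n) := by
  obtain ⟨l, a, c, hl, h1, h2⟩ := exists_pairs_of_sideCond hm hn k C (st k D) h
  rw [h2, hatSpectrum, regular_and_hat_iff (a := a) (c := c) (add_comm n m)
    (by rw [Fintype.card_fin]; omega)]
  · apply isDet_pencilQ
    simpa [pairProd_X_one] using h1 X 1
  · apply isDet_rev_pencilQ
    refine IsDet.of_C_mul (neg_one_pow_ne_zero_complex l) ?_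
    convert h1 1 X using 1
    rw [pairProd_one_X, Fintype.card_fin]
    ring

/-- Taking X^⋆ as the unknown exchanges (A, B) with (C, D) and x with y. The pairs are inverted,
which `PairCond` does not see, and the forced eigenvalues move from ∞ to 0. -/
theorem bijective_iff_of_swap_of_sideCond (hm : 0 < m) (hn : 0 < n) (A : Matrix (Fin n) (Fin m) ℂ)
    (B : Matrix (Fin n) (Fin m) ℂ) {C : Matrix (Fin n) (Fin n) ℂ} {D : Matrix (Fin m) (Fin m) ℂ}
    (h : SideCond C (st k D)) : Function.Bijective (op k A (st k B) C (st k D)) ↔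
      (pencilQ k A B C D).IsRegular ∧
        SpectralCondition k (pencilQ k A B C D) (tildeSpectrum (pencilQ k A B C D) m n) := by
  obtain ⟨l, a, c, hl, h1, h2⟩ := exists_pairs_of_sideCond hn hm k A (st k B) h
  have habs : ((n : ℤ) - m).natAbs = ((m : ℤ) - n).natAbs := by omega
  rw [habs] at hl h1
  rw [← op_swap_bijective, h2, pairCond_comm, tildeSpectrum,
    regular_and_tilde_iff (a := c) (c := a) rfl (by rw [Fintype.card_fin]; omega)]
  apply isDet_pencilQ
  refine IsDet.of_submatrix (Equiv.refl _) (Equiv.sumComm _ _) ?_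
  rw [blockPencil_swap]
  refine IsDet.of_C_mul (neg_one_pow_ne_zero_complex l) ?_
  convert h1 1 X using 1
  rw [pairProd_one_X, Fintype.card_fin]
  ring

theorem bijective_iff_of_square (A B C D : Matrix (Fin n) (Fin n) ℂ) :
    Function.Bijective (op k A (st k B) C (st k D)) ↔ (pencilQ k A B C D).IsRegular ∧
      SpectralCondition k (pencilQ k A B C D) (pencilQ k A B C D).spectrum := by
  obtain ⟨a, c, h1, h2⟩ := exists_pairs_square k A (st k B) C (st k D)
  rw [h2, regular_and_spectrum_iff (a := a) (c := c) rfl (by rw [Fintype.card_fin]; omega)]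
  apply isDet_pencilQ
  simpa [pairProd_X_one] using h1 X 1

end Main

end StarSylvester

end

open StarSylvester in
theorem theorem1p3 {p m n q : ℕ} (hm : 0 < m) (hn : 0 < n) (k : StarSylvester.StarKind)
    (A : Matrix (Fin p) (Fin m) ℂ) (B : Matrix (Fin n) (Fin q) ℂ)
    (C : Matrix (Fin p) (Fin n) ℂ) (D : Matrix (Fin m) (Fin q) ℂ) :
    (∀ E : Matrix (Fin p) (Fin q) ℂ,
        ∃! X : Matrix (Fin m) (Fin n) ℂ, A * X * B + C * k.app X * D = E) ↔
      (StarSylvester.pencilQ k A B C D).IsRegular ∧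
        ((p = m ∧ m ≠ n ∧ n = q ∧
            ((n < m ∧ StarSylvester.IsInvertible B) ∨ (m < n ∧ StarSylvester.IsInvertible A)) ∧
            StarSylvester.SpectralCondition k (StarSylvester.pencilQ k A B C D)
              (StarSylvester.hatSpectrum (StarSylvester.pencilQ k A B C D) m n)) ∨
          (p = n ∧ n ≠ m ∧ m = q ∧
            ((n < m ∧ StarSylvester.IsInvertible C) ∨ (m < n ∧ StarSylvester.IsInvertible D)) ∧
            StarSylvester.SpectralCondition k (StarSylvester.pencilQ k A B C D)
              (StarSylvester.tildeSpectrum (StarSylvester.pencilQ k A B C D) m n)) ∨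
          (p = m ∧ m = n ∧ n = q ∧
            StarSylvester.SpectralCondition k (StarSylvester.pencilQ k A B C D)
              (StarSylvester.pencilQ k A B C D).spectrum)) := by
  have hop : (fun X => A * X * B + C * k.app X * D) = op k A (st k B) C (st k D) := by
    funext X
    simp [op, app_eq_st]
  rw [← Function.bijective_iff_existsUnique (fun X => A * X * B + C * k.app X * D), hop]
  constructor
  · intro h
    rcases card_eq_of_bijective hm hn h with ⟨rfl, rfl⟩ | ⟨rfl, rfl⟩
    · by_cases hmn : p = n
      · subst hmn
        obtain ⟨h1, h2⟩ := (bijective_iff_of_square A B C D).1 h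
        exact ⟨h1, Or.inr (Or.inr ⟨rfl, rfl, rfl, h2⟩)⟩
      · have hs := sideCond_of_bijective hmn h
        obtain ⟨h1, h2⟩ := (bijective_iff_of_eq_of_sideCond hm hn C D hs).1 h
        rw [SideCond, isInvertible_st] at hs
        exact ⟨h1, Or.inl ⟨rfl, hmn, rfl, hs, h2⟩⟩
    · by_cases hmn : p = m
      · subst hmn
        obtain ⟨h1, h2⟩ := (bijective_iff_of_square A B C D).1 h
        exact ⟨h1, Or.inr (Or.inr ⟨rfl, rfl, rfl, h2⟩)⟩
      · have hs := sideCond_of_bijective hmn ((op_swap_bijective k _ _ _ _).2 h)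
        obtain ⟨h1, h2⟩ := (bijective_iff_of_swap_of_sideCond hm hn A B hs).1 h
        rw [SideCond, isInvertible_st, or_comm] at hs
        exact ⟨h1, Or.inr (Or.inl ⟨rfl, hmn, rfl, hs, h2⟩)⟩
  · rintro ⟨h1, ⟨rfl, hmn, rfl, hs, h2⟩ | ⟨rfl, hmn, rfl, hs, h2⟩ | ⟨rfl, rfl, rfl, h2⟩⟩
    · rw [← isInvertible_st (k := k)] at hs
      exact (bijective_iff_of_eq_of_sideCond hm hn C D hs).2 ⟨h1, h2⟩
    · rw [or_comm, ← isInvertible_st (k := k)] at hs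
      exact (bijective_iff_of_swap_of_sideCond hm hn A B hs).2 ⟨h1, h2⟩
    · exact (bijective_iff_of_square A B C D).2 ⟨h1, h2⟩
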